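/- Let $n\in\mathbb N$, $a<b$, $\mathcal J=\begin{pmatrix}0&I\\-I&0\end{pmatrix}\in\mathbb R^{2n\times 2n}$, $E=\begin{pmatrix}0\\ I\end{pmatrix}\in\mathbb R^{2n\times n}$. A continuous Lagrangian path on $[a,b]$ is a continuous $Y=\begin{pmatrix}X\\U\end{pmatrix}:[a,b]\to\mathbb R^{2n\times n}$ with $Y^T\mathcal JY=0$ and $\operatorname{rank}Y=n$ on $[a,b]$. Put $W(Y,\hat Y)=Y^T\mathcal J\hat Y$, $K_Y=(Y^TY)^{-1/2}$, $Z_Y=(\mathcal JYK_Y\ \ YK_Y)$. A real $2n\times2n$ matrix $S$ is symplectic if $S^T\mathcal JS=\mathcal J$. *Lidskii angles.* For a symplectic $S=\begin{pmatrix}S_{11}&S_{12}\\S_{21}&S_{22}\end{pmatrix}$ these are real numbers $\varphi_1,\dots,\varphi_n$ such that $e^{i\varphi_1},\dots,e^{i\varphi_n}$ are the eigenvalues, with multiplicity, of $(S_{11}-iS_{12})^{-1}(S_{11}+iS_{12})$. *Maslov index.* For continuous Lagrangian paths $Y,\hat Y$ let $\Gamma=-(X+iU)(X-iU)^{-1}(\hat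 X-i\hat U)(\hat X+i\hat U)^{-1}$. Choose a partition $a=t_0<\dots<t_p=b$ and $\varepsilon_k\in(0,\pi)$ such that $e^{i(\pi\pm\varepsilon_k)}$ are not eigenvalues of $\Gamma(t)$ for $t\in[t_{k-1},t_k]$, and let $\ell(t,\varepsilon_k)=\sum_{\theta\in[0,\varepsilon_k)}\dim\ker(\Gamma(t)-e^{i(\pi+\theta)}I)$. Then $\mathrm{Mas}(Y,\hat Y;[a,b])=\sum_{k=1}^p(\ell(t_k,\varepsilon_k)-\ell(t_{k-1},\varepsilon_k))$. *Oscillation number.* For Lagrangian $Y,\hat Y$ (constant matrices) the comparative index is $\mu(Y,\hat Y)=\operatorname{rank}\mathcal M+\operatorname{ind}\mathcal P$, where $\mathcal M=(I-X^\dagger X)W(Y,\hat Y)$, $V=I-\mathcal M^\dagger\mathcal M$, $\mathcal P=V\,W(Y,\hat Y)^TX^\dagger\hat X V$, $\dagger$ is the Moore–Penrose inverse and $\operatorname{ind}$ the number of negative eigenvalues. For a continuous Lagrangian path $Y$ choose a partition $a=t_0<\dots<t_p=b$ and symplectic matrix functions $R_k$, continuous on $[t_k,t_{k+1}]$, such that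 $\operatorname{rank}W(R_k(t)E,Y(t))$ and $\operatorname{rank}\big((I\ 0)R_k(t)E\big)$ are constant on $[t_k,t_{k+1}]$, $k=0,\dots,p-1$. Then $\mathcal N(Y,[a,b])=\sum_{k=0}^{p-1}\big(\mu(Y(t_{k+1}),R_k(t_{k+1})E)-\mu(Y(t_k),R_k(t_k)E)\big)$. **Theorem.** Let $Y,\hat Y$ be continuous Lagrangian paths on $[a,b]$ and $S(t)=Z_Y^{-1}(t)Z_{\hat Y}(t)=Z_Y^T(t)Z_{\hat Y}(t)$. Then $\mathrm{Mas}(Y,\hat Y;[a,b])$ is well defined (admissible choices exist and all give the same value), the Lidskii angles of $S(t)$ can be chosen as continuous functions on $[a,b]$, and for every such choice $\varphi_1,\dots,\varphi_n$, $$\mathrm{Mas}(Y,\hat Y;[a,b])=\sum_{j=1}^n\big(q_j(b)-q_j(a)\big),\qquad q_j(t)=\Big\lfloor\frac{\varphi_j(t)}{2\pi}\Big\rfloor .$$ Consequently, for every continuous symplectic $Z$ on $[a,b]$ with $Z(t)E=Y(t)$, the functions $Z^{-1}\hat Y$ and $$\tilde Y:=Z_Y^{-1}\hat Y=\begin{pmatrix}-K_Y\,W(Y,\hat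 Y)\\ K_Y\,Y^T\hat Y\end{pmatrix}$$ are continuous Lagrangian paths whose oscillation numbers are well defined (in the same sense), and $$\mathrm{Mas}(Y,\hat Y;[a,b])=\mathcal N(Z^{-1}\hat Y,[a,b])=\mathcal N(\tilde Y,[a,b]).$$ -/

import Mathlib

open Matrix

namespace OscMaslov

noncomputable section

/-- Real `2n × n` matrices `Y = (X; U)`; the row index `Sum.inl` is the block `X`, the row index
`Sum.inr` the block `U`. -/
abbrev Frame (n : ℕ) := Matrix (Fin n ⊕ Fin n) (Fin n) ℝ

/-- Real `2n × 2n` matrices, partitioned into `n × n` blocks. -/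
abbrev BMat (n : ℕ) := Matrix (Fin n ⊕ Fin n) (Fin n ⊕ Fin n) ℝ

/-- The canonical skew-symmetric matrix `𝒥 = (0 I; -I 0)` (this is `-Matrix.J`). -/
def calJ (n : ℕ) : BMat n := fromBlocks 0 1 (-1) 0

/-- The vertical Lagrangian plane `E = (0 I)ᵀ`. -/
def vertE (n : ℕ) : Frame n := fromRows 0 1

/-- `S` is symplectic. Mathlib's symplectic group is given by `S J Sᵀ = J` with `J = -𝒥`, which is
equivalent to `Sᵀ 𝒥 S = 𝒥`. -/
def IsSymplectic {n : ℕ} (S : BMat n) : Prop := S ∈ Matrix.symplecticGroup (Fin n) ℝ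

/-- A (constant) Lagrangian frame: `Yᵀ 𝒥 Y = 0` and `rank Y = n`. -/
def IsLagrangian {n : ℕ} (Y : Frame n) : Prop := Yᵀ * calJ n * Y = 0 ∧ Y.rank = n

/-- A continuous Lagrangian path on `[a, b]`. -/
def IsLagrangianPath {n : ℕ} (Y : ℝ → Frame n) (a b : ℝ) : Prop :=
  ContinuousOn Y (Set.Icc a b) ∧ ∀ t ∈ Set.Icc a b, IsLagrangian (Y t)

/-- The Wronskian `W(Y, Ŷ) = Yᵀ 𝒥 Ŷ`. -/
def wronskian {n : ℕ} (Y Yh : Frame n) : Matrix (Fin n) (Fin n) ℝ := Yᵀ * calJ n * Yh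

/-- `K_Y = (Yᵀ Y)^{-1/2}`, the inverse square root of a symmetric positive definite matrix. -/
def matK {n : ℕ} (Y : Frame n) : Matrix (Fin n) (Fin n) ℝ :=
  cfc (fun x : ℝ => x ^ (-(1 / 2) : ℝ)) (Yᵀ * Y)

/-- `Z_Y = (𝒥 Y K_Y, Y K_Y)`. -/
def matZ {n : ℕ} (Y : Frame n) : BMat n := fromCols (calJ n * Y * matK Y) (Y * matK Y)

/-! ### Lidskii angles -/

/-- `W_S = (S₁₁ - i S₁₂)⁻¹ (S₁₁ + i S₁₂)`. -/
def matW {n : ℕ} (S : BMat n) : Matrix (Fin n) (Fin n) ℂ :=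
  (S.toBlocks₁₁.map Complex.ofReal - Complex.I • S.toBlocks₁₂.map Complex.ofReal)⁻¹ *
    (S.toBlocks₁₁.map Complex.ofReal + Complex.I • S.toBlocks₁₂.map Complex.ofReal)

/-- `φ₁, …, φₙ` are Lidskii angles of `S`: the numbers `exp (i φⱼ)` are the eigenvalues of `W_S`,
listed with multiplicity. -/
def IsLidskiiAngles {n : ℕ} (S : BMat n) (φ : Fin n → ℝ) : Prop :=
  (matW S).charpoly.roots =
    Finset.univ.val.map fun j : Fin n => Complex.exp (Complex.I * (φ j : ℂ))

/-- Continuous branches on `[a, b]` of the Lidskii angles of a matrix function `S(t)`. -/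
def IsContinuousLidskiiAngles {n : ℕ} (S : ℝ → BMat n) (φ : Fin n → ℝ → ℝ) (a b : ℝ) : Prop :=
  (∀ j, ContinuousOn (φ j) (Set.Icc a b)) ∧
    ∀ t ∈ Set.Icc a b, IsLidskiiAngles (S t) fun j => φ j t

/-- The integer `q` with `φ ∈ [2πq, 2π(q+1))`. -/
def windInt (φ : ℝ) : ℤ := ⌊φ / (2 * Real.pi)⌋

/-! ### Comparative index -/

/-- The four Penrose equations for a real square matrix. -/
def IsMoorePenrose {n : ℕ} (A B : Matrix (Fin n) (Fin n) ℝ) : Prop :=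
  A * B * A = A ∧ B * A * B = B ∧ (A * B)ᵀ = A * B ∧ (B * A)ᵀ = B * A

theorem exists_isMoorePenrose {n : ℕ} (A : Matrix (Fin n) (Fin n) ℝ) :
    ∃ B, IsMoorePenrose A B := by
  set H := Aᵀ * A with hH
  have hHs : Hᵀ = H := by rw [hH]; simp
  have hs : IsSelfAdjoint H := by
    rw [IsSelfAdjoint, Matrix.star_eq_conjTranspose, conjTranspose_eq_transpose_of_trivial, hHs]
  have hc : ∀ f : ℝ → ℝ, ContinuousOn f (spectrum ℝ H) :=
    fun f => (Matrix.finite_spectrum H).continuousOn f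
  set G := cfc (fun x : ℝ => x⁻¹) H with hG
  have hGs : Gᵀ = G := by
    have h : IsSelfAdjoint G := cfc_predicate _ _
    rwa [IsSelfAdjoint, Matrix.star_eq_conjTranspose, conjTranspose_eq_transpose_of_trivial] at h
  have hid : cfc (fun x : ℝ => x) H = H := cfc_id' ℝ H
  have hcomm : G * H = H * G := by
    have h := cfc_commute_cfc (fun x : ℝ => x⁻¹) (fun x : ℝ => x) H
    rw [hid] at h
    exact h
  have hHGH : H * G * H = H := by
    have h1 := cfc_mul (fun x : ℝ => x) (fun x : ℝ => x⁻¹) H (hc _) (hc _)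
    have h2 := cfc_mul (fun x : ℝ => x * x⁻¹) (fun x : ℝ => x) H (hc _) (hc _)
    rw [h1, hid] at h2
    rw [hG, ← h2]
    simpa using hid
  have hGHG : G * H * G = G := by
    have h1 := cfc_mul (fun x : ℝ => x⁻¹) (fun x : ℝ => x) H (hc _) (hc _)
    have h2 := cfc_mul (fun x : ℝ => x⁻¹ * x) (fun x : ℝ => x⁻¹) H (hc _) (hc _)
    rw [h1, hid] at h2
    rw [hG, ← h2]
    refine cfc_congr fun x _ => ?_
    by_cases hx : x = 0 <;> simp [hx]
  have hAGH : A * (G * H) = A := by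
    have h0 : (A * (G * H) - A)ᵀ * (A * (G * H) - A) = 0 := by
      have e : ∀ M : Matrix (Fin n) (Fin n) ℝ,
          (A * M - A)ᵀ * (A * M - A) = Mᵀ * H * M - Mᵀ * H - H * M + H := by
        intro M
        rw [transpose_sub, transpose_mul, hH]
        noncomm_ring
      have hT : (G * H)ᵀ = H * G := by rw [transpose_mul, hGs, hHs]
      rw [e, hT, hHGH, ← Matrix.mul_assoc, hHGH, sub_self, zero_sub, neg_add_cancel]
    rw [← conjTranspose_eq_transpose_of_trivial, conjTranspose_mul_self_eq_zero] at h0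
    exact sub_eq_zero.mp h0
  refine ⟨G * Aᵀ, ?_, ?_, ?_, ?_⟩
  · rw [Matrix.mul_assoc, Matrix.mul_assoc, ← hH, hAGH]
  · rw [Matrix.mul_assoc G Aᵀ A, ← hH, ← Matrix.mul_assoc, hGHG]
  · simp [transpose_mul, hGs, Matrix.mul_assoc]
  · rw [Matrix.mul_assoc, ← hH, transpose_mul, hGs, hHs, hcomm]

/-- The Moore–Penrose pseudoinverse `A†` (the Penrose equations determine it uniquely). -/
def pinv {n : ℕ} (A : Matrix (Fin n) (Fin n) ℝ) : Matrix (Fin n) (Fin n) ℝ :=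
  (exists_isMoorePenrose A).choose

/-- `ind P`: the number of negative eigenvalues, with multiplicity, of a symmetric matrix. -/
def negIndex {n : ℕ} (P : Matrix (Fin n) (Fin n) ℝ) : ℕ :=
  (P.charpoly.roots.filter fun x => x < 0).card

/-- `ℳ = (I - X† X) W(Y, Ŷ)`. -/
def compM {n : ℕ} (Y Yh : Frame n) : Matrix (Fin n) (Fin n) ℝ :=
  (1 - pinv Y.toRows₁ * Y.toRows₁) * wronskian Y Yh

/-- `V = I - ℳ† ℳ`. -/
def compV {n : ℕ} (Y Yh : Frame n) : Matrix (Fin n) (Fin n) ℝ :=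
  1 - pinv (compM Y Yh) * compM Y Yh

/-- `𝒫 = V W(Y, Ŷ)ᵀ X† X̂ V`. -/
def compP {n : ℕ} (Y Yh : Frame n) : Matrix (Fin n) (Fin n) ℝ :=
  compV Y Yh * (wronskian Y Yh)ᵀ * pinv Y.toRows₁ * Yh.toRows₁ * compV Y Yh

/-- The comparative index `μ(Y, Ŷ) = rank ℳ + ind 𝒫`. -/
def compIndex {n : ℕ} (Y Yh : Frame n) : ℕ := (compM Y Yh).rank + negIndex (compP Y Yh)

/-! ### Oscillation number -/

/-- `a = t₀ < t₁ < ⋯ < t_p = b`. -/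
structure IsPartition {p : ℕ} (t : Fin (p + 1) → ℝ) (a b : ℝ) : Prop where
  strictMono : StrictMono t
  first : t 0 = a
  last : t (Fin.last p) = b

/-- The condition on the matrix functions `R₀, …, R_{p-1}`: on `[t_k, t_{k+1}]` the matrix `R_k` is
continuous and symplectic, and both the rank of `W(R_k E, Y)` (equivalently, of the upper block of
`R_k⁻¹ Y`) and the rank of `(I 0) R_k E` are constant. -/
def IsOscSystem {n p : ℕ} (Y : ℝ → Frame n) (t : Fin (p + 1) → ℝ) (R : Fin p → ℝ → BMat n) :
    Prop :=
  ∀ k : Fin p,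
    ContinuousOn (R k) (Set.Icc (t k.castSucc) (t k.succ)) ∧
    (∀ s ∈ Set.Icc (t k.castSucc) (t k.succ), IsSymplectic (R k s)) ∧
    (∃ r : ℕ, ∀ s ∈ Set.Icc (t k.castSucc) (t k.succ),
      (wronskian (R k s * vertE n) (Y s)).rank = r) ∧
    (∃ r : ℕ, ∀ s ∈ Set.Icc (t k.castSucc) (t k.succ),
      (R k s * vertE n).toRows₁.rank = r)

/-- `∑_k (μ(Y(t_{k+1}), R_k(t_{k+1}) E) - μ(Y(t_k), R_k(t_k) E))`. -/
def oscSum {n p : ℕ} (Y : ℝ → Frame n) (t : Fin (p + 1) → ℝ) (R : Fin p → ℝ → BMat n) : ℤ :=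
  ∑ k : Fin p,
    ((compIndex (Y (t k.succ)) (R k (t k.succ) * vertE n) : ℤ) -
      (compIndex (Y (t k.castSucc)) (R k (t k.castSucc) * vertE n) : ℤ))

/-- All values of `oscSum` over the partitions of `[a, b]` and systems `R` allowed for `Y`. -/
def oscValues {n : ℕ} (Y : ℝ → Frame n) (a b : ℝ) : Set ℤ :=
  {m | ∃ (p : ℕ) (t : Fin (p + 1) → ℝ) (R : Fin p → ℝ → BMat n),
    IsPartition t a b ∧ IsOscSystem Y t R ∧ oscSum Y t R = m}

/-- The oscillation number of `Y` on `[a, b]`: the value of `oscSum` for any allowed choice (it is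
meaningful when `oscValues Y a b` has exactly one element). -/
def oscNumber {n : ℕ} (Y : ℝ → Frame n) (a b : ℝ) : ℤ :=
  Classical.epsilon fun m : ℤ => m ∈ oscValues Y a b

/-! ### Maslov index -/

/-- `X + i U`. -/
def cPlus {n : ℕ} (Y : Frame n) : Matrix (Fin n) (Fin n) ℂ :=
  Y.toRows₁.map Complex.ofReal + Complex.I • Y.toRows₂.map Complex.ofReal

/-- `X - i U`. -/
def cMinus {n : ℕ} (Y : Frame n) : Matrix (Fin n) (Fin n) ℂ :=
  Y.toRows₁.map Complex.ofReal - Complex.I • Y.toRows₂.map Complex.ofReal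

/-- `Γ = -(X + iU)(X - iU)⁻¹(X̂ - iÛ)(X̂ + iÛ)⁻¹`. -/
def matGamma {n : ℕ} (Y Yh : Frame n) : Matrix (Fin n) (Fin n) ℂ :=
  -(cPlus Y * (cMinus Y)⁻¹ * cMinus Yh * (cPlus Yh)⁻¹)

/-- `Γ - exp (i θ) I`. -/
def gammaShift {n : ℕ} (Y Yh : Frame n) (θ : ℝ) : Matrix (Fin n) (Fin n) ℂ :=
  matGamma Y Yh - Complex.exp (Complex.I * (θ : ℂ)) • (1 : Matrix (Fin n) (Fin n) ℂ)

/-- The defect `def A`: the dimension of the kernel. -/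
def defect {n : ℕ} (A : Matrix (Fin n) (Fin n) ℂ) : ℕ :=
  Module.finrank ℂ (LinearMap.ker (Matrix.toLin' A))

/-- `ℓ(ε) = ∑_{θ ∈ [0, ε)} def (Γ - exp (i (π + θ)) I)`, a sum with finitely many nonzero terms. -/
def arcCount {n : ℕ} (Y Yh : Frame n) (ε : ℝ) : ℕ :=
  ∑ᶠ θ ∈ Set.Ico (0 : ℝ) ε, defect (gammaShift Y Yh (Real.pi + θ))

/-- The condition on `ε_k ∈ (0, π)`: on `[t_k, t_{k+1}]` neither of the numbers
`exp (i (π ± ε_k))` is an eigenvalue of `Γ(t)`. -/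
def IsMaslovSystem {n p : ℕ} (Y Yh : ℝ → Frame n) (t : Fin (p + 1) → ℝ) (ε : Fin p → ℝ) : Prop :=
  ∀ k : Fin p, ε k ∈ Set.Ioo 0 Real.pi ∧
    ∀ s ∈ Set.Icc (t k.castSucc) (t k.succ),
      IsUnit (gammaShift (Y s) (Yh s) (Real.pi + ε k)) ∧
      IsUnit (gammaShift (Y s) (Yh s) (Real.pi - ε k))

/-- `∑_k (ℓ(t_{k+1}, ε_k) - ℓ(t_k, ε_k))`. -/
def maslovSum {n p : ℕ} (Y Yh : ℝ → Frame n) (t : Fin (p + 1) → ℝ) (ε : Fin p → ℝ) : ℤ :=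
  ∑ k : Fin p,
    ((arcCount (Y (t k.succ)) (Yh (t k.succ)) (ε k) : ℤ) -
      (arcCount (Y (t k.castSucc)) (Yh (t k.castSucc)) (ε k) : ℤ))

/-- All values of `maslovSum` over the allowed partitions of `[a, b]` and numbers `ε_k`. -/
def maslovValues {n : ℕ} (Y Yh : ℝ → Frame n) (a b : ℝ) : Set ℤ :=
  {m | ∃ (p : ℕ) (t : Fin (p + 1) → ℝ) (ε : Fin p → ℝ),
    IsPartition t a b ∧ IsMaslovSystem Y Yh t ε ∧ maslovSum Y Yh t ε = m}

/-- The Maslov index `Mas(Y, Ŷ; [a, b])`: the value of `maslovSum` for any allowed choice (it is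
meaningful when `maslovValues Y Yh a b` has exactly one element). -/
def maslovIndex {n : ℕ} (Y Yh : ℝ → Frame n) (a b : ℝ) : ℤ :=
  Classical.epsilon fun m : ℤ => m ∈ maslovValues Y Yh a b

end

end OscMaslov

open OscMaslov

/-! All three quantities are read off from one matrix, `phase F` $=(U-iX)^{-1}(U+iX)$ for the frame
$F=Z_Y^T\hat Y$. Both $-\Gamma$ and the matrix defining the Lidskii angles of $S$ are similar to it
(`IsLagrangian.neg_matGamma`, `matW_transpose_mul`), so continuous Lidskii angles are continuous
arguments of its eigenvalues (`IsBranch`). Every index is shown to be the increment of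
$\sum_j\lfloor\varphi_j/2\pi\rfloor$.

Maslov index: the arc count is
$\ell(\varepsilon)=\sum_j(\lfloor\varphi_j/2\pi\rfloor-\lfloor(\varphi_j-\varepsilon)/2\pi\rfloor)$
(`arcCount_eq`). The second floors are frozen as long as $e^{i\varepsilon}$ is not an eigenvalue of
the phase, so the defining sum telescopes.

Oscillation number: choose $\kappa$ with $\kappa X-U$ invertible. Then $B=X(\kappa X-U)^{-1}$ is
symmetric, and an eigenvalue $x$ of $B$ gives the angle $2\arg(1-(\kappa+i)x)$, whose floor is $-1$
for $x>0$ and $0$ otherwise. Hence $\sum_j\lfloor\varphi_j/2\pi\rfloor$ plus the number of positive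
eigenvalues of $B$ is locally constant (`IsLagrangianPath.eventually_sum_windInt`). If the second
frame has the matrix $C$ in the same coordinates, computing the inertia of one block matrix in two
ways gives $\mu+\mathrm{pos}\,B=\mathrm{pos}\,C+\mathrm{pos}(B-C)$
(`GraphPair.compIndex_add_posIdx`). The rank conditions on $R_k$ say that $C$ and $B-C$ have
constant rank, which makes their inertia locally constant. So $\mu$ and
$\sum_j\lfloor\varphi_j/2\pi\rfloor$ change by the same amount.

Another $Z$ with $ZE=Y$ differs from $Z_Y$ by a symplectic factor preserving the vertical plane, and
such factors leave comparative indices unchanged (`oscValues_subset_of_lower`). -/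

namespace OscMaslov

open Filter Topology

/-! ### Inertia of real symmetric matrices -/

section Inertia

set_option linter.unusedSectionVars false

variable {ι κ : Type*} [Fintype ι] [DecidableEq ι] [Fintype κ] [DecidableEq κ]

/-- The positive index of inertia of a real symmetric matrix. -/
noncomputable def posIdx (A : Matrix ι ι ℝ) : ℕ := (A.charpoly.roots.filter fun x => 0 < x).card

theorem isHermitian_iff_transpose {A : Matrix ι ι ℝ} : A.IsHermitian ↔ Aᵀ = A := by
  rw [Matrix.IsHermitian, conjTranspose_eq_transpose_of_trivial]

theorem real_spectral {A : Matrix ι ι ℝ} (hA : A.IsHermitian) :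
    ∃ Q : Matrix ι ι ℝ, Qᵀ * Q = 1 ∧ Q * Qᵀ = 1 ∧ A = Q * diagonal hA.eigenvalues * Qᵀ := by
  refine ⟨hA.eigenvectorUnitary, ?_, ?_, ?_⟩
  · have := Unitary.coe_star_mul_self hA.eigenvectorUnitary
    rwa [star_eq_conjTranspose, conjTranspose_eq_transpose_of_trivial] at this
  · have := Unitary.coe_mul_star_self hA.eigenvectorUnitary
    rwa [Unitary.coe_star, star_eq_conjTranspose, conjTranspose_eq_transpose_of_trivial] at this
  · have := hA.spectral_theorem
    rw [Unitary.conjStarAlgAut_apply, star_eq_conjTranspose,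
      conjTranspose_eq_transpose_of_trivial] at this
    exact this

theorem roots_charpoly_conj_diagonal {K : Type*} [Field K] {P Q : Matrix ι ι K} (h : Q * P = 1)
    (d : ι → K) : (P * diagonal d * Q).charpoly.roots = Finset.univ.val.map d := by
  rw [charpoly_mul_comm, ← Matrix.mul_assoc, h, Matrix.one_mul, charpoly_diagonal,
    Polynomial.roots_prod _ _ (Finset.prod_ne_zero_iff.mpr fun i _ => Polynomial.X_sub_C_ne_zero _)]
  simp only [Polynomial.roots_X_sub_C, Multiset.bind_singleton]

theorem posIdx_eq_card {A : Matrix ι ι ℝ} (hA : A.IsHermitian) :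
    posIdx A = Fintype.card {i // 0 < hA.eigenvalues i} := by
  rw [posIdx, hA.roots_charpoly_eq_eigenvalues, Multiset.filter_map, Multiset.card_map,
    Fintype.card_subtype, Finset.card_def, Finset.filter_val]
  rfl

theorem roots_charpoly_neg {A : Matrix ι ι ℝ} (hA : A.IsHermitian) :
    (-A).charpoly.roots = A.charpoly.roots.map Neg.neg := by
  obtain ⟨Q, h1, h2, h3⟩ := real_spectral hA
  have e : -A = Q * (diagonal fun i => -hA.eigenvalues i) * Qᵀ := by
    conv_lhs => rw [h3]
    have : (diagonal fun i => -hA.eigenvalues i) = -diagonal hA.eigenvalues := by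
      rw [diagonal_neg]
    rw [this]
    simp only [Matrix.neg_mul, Matrix.mul_neg]
  rw [e, roots_charpoly_conj_diagonal h1, hA.roots_charpoly_eq_eigenvalues, Multiset.map_map]
  rfl

theorem card_filter_neg_eq_posIdx_neg {A : Matrix ι ι ℝ} (hA : A.IsHermitian) :
    (A.charpoly.roots.filter fun x => x < 0).card = posIdx (-A) := by
  rw [posIdx, roots_charpoly_neg hA, Multiset.filter_map, Multiset.card_map]
  simp

theorem posIdx_add_posIdx_neg {A : Matrix ι ι ℝ} (hA : A.IsHermitian) :
    posIdx A + posIdx (-A) = A.rank := by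
  rw [← card_filter_neg_eq_posIdx_neg hA, posIdx, ← Multiset.card_add, hA.rank_eq_card_non_zero_eigs,
    hA.roots_charpoly_eq_eigenvalues, Fintype.card_subtype, Finset.card_def, Finset.filter_val,
    Multiset.filter_map, Multiset.filter_map, ← Multiset.map_add, Multiset.card_map,
    Multiset.filter_add_filter]
  have : (Multiset.filter (fun a => ((fun x : ℝ => 0 < x) ∘ (RCLike.ofReal ∘ hA.eigenvalues)) a ∧
      ((fun x : ℝ => x < 0) ∘ (RCLike.ofReal ∘ hA.eigenvalues)) a)
      (Finset.univ : Finset ι).val) = 0 := by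
    rw [Multiset.filter_eq_nil]
    rintro a - ⟨h1, h2⟩
    exact lt_asymm h1 h2
  rw [this, add_zero]
  congr 1
  refine Multiset.filter_congr fun i _ => ?_
  simp only [Function.comp, RCLike.ofReal_real_eq_id, id, ne_eq]
  rw [or_comm]
  exact lt_or_lt_iff_ne

/-- A subspace, spanned by the columns of `C`, on which `A` is positive definite has dimension at
most the positive index. -/
theorem card_le_posIdx_of_posDef {A : Matrix ι ι ℝ} (hA : A.IsHermitian) (C : Matrix ι κ ℝ)
    (h : ∀ x : κ → ℝ, x ≠ 0 → 0 < x ⬝ᵥ ((Cᵀ * A * C) *ᵥ x)) : Fintype.card κ ≤ posIdx A := by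
  obtain ⟨Q, h1, h2, h3⟩ := real_spectral hA
  rw [posIdx_eq_card hA]
  -- Coordinates of $Cx$ along the eigenvectors with positive eigenvalue. If they all vanish, the
  -- form is nonpositive at $x$, so $x=0$.
  let f : (κ → ℝ) →ₗ[ℝ] ({i // 0 < hA.eigenvalues i} → ℝ) :=
    LinearMap.funLeft ℝ ℝ Subtype.val ∘ₗ (Qᵀ * C).mulVecLin
  have hf : Function.Injective f := by
    rw [← LinearMap.ker_eq_bot, LinearMap.ker_eq_bot']
    intro x hx
    by_contra hne
    have h0 := h x hne
    have e : x ⬝ᵥ ((Cᵀ * A * C) *ᵥ x) =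
        ∑ i, hA.eigenvalues i * ((Qᵀ * C) *ᵥ x) i ^ 2 := by
      have : Cᵀ * A * C = (Qᵀ * C)ᵀ * diagonal hA.eigenvalues * (Qᵀ * C) := by
        conv_lhs => rw [h3]
        simp [Matrix.mul_assoc]
      rw [this, ← mulVec_mulVec, ← mulVec_mulVec, dotProduct_mulVec, vecMul_transpose, dotProduct]
      refine Finset.sum_congr rfl fun i _ => ?_
      rw [mulVec_diagonal]
      ring
    rw [e] at h0
    refine absurd h0 (not_lt.mpr (Finset.sum_nonpos fun i _ => ?_))
    by_cases hi : 0 < hA.eigenvalues i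
    · have : ((Qᵀ * C) *ᵥ x) i = 0 := congrFun hx ⟨i, hi⟩
      rw [this]; simp
    · exact mul_nonpos_of_nonpos_of_nonneg (not_lt.mp hi) (sq_nonneg _)
  have := LinearMap.finrank_le_finrank_of_injective hf
  simpa using this

/-- The eigenvectors with positive eigenvalue serve as columns. With `card_le_posIdx_of_posDef` this
makes the positive index the largest dimension of a positive definite subspace, the form in which it
is compared below. -/
theorem exists_posDef_card_eq_posIdx {A : Matrix ι ι ℝ} (hA : A.IsHermitian) :
    ∃ C : Matrix ι (Fin (posIdx A)) ℝ,
      ∀ x : Fin (posIdx A) → ℝ, x ≠ 0 → 0 < x ⬝ᵥ ((Cᵀ * A * C) *ᵥ x) := by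
  obtain ⟨Q, h1, h2, h3⟩ := real_spectral hA
  let e : Fin (posIdx A) ≃ {i // 0 < hA.eigenvalues i} :=
    (Fintype.equivFinOfCardEq (posIdx_eq_card hA).symm).symm
  refine ⟨Q.submatrix id fun k => (e k : ι), fun x hx => ?_⟩
  have key : (Q.submatrix id fun k => (e k : ι))ᵀ * A * (Q.submatrix id fun k => (e k : ι)) =
      diagonal fun k => hA.eigenvalues (e k) := by
    have : Qᵀ * A * Q = diagonal hA.eigenvalues := by
      conv_lhs => rw [h3]
      simp only [Matrix.mul_assoc, h1, Matrix.mul_one]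
      rw [← Matrix.mul_assoc, h1, Matrix.one_mul]
    have e2 : (Q.submatrix id fun k => (e k : ι))ᵀ * A * (Q.submatrix id fun k => (e k : ι)) =
        (Qᵀ * A * Q).submatrix (fun k => (e k : ι)) (fun k => (e k : ι)) := by
      ext i j
      simp [Matrix.mul_apply]
    rw [e2, this]
    ext i j
    by_cases hij : i = j
    · simp [hij]
    · have : (e i : ι) ≠ e j := fun h => hij (e.injective (Subtype.ext h))
      simp [hij, this]
  rw [key]
  obtain ⟨k, hk⟩ := Function.ne_iff.mp hx
  simp only [dotProduct, mulVec_diagonal]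
  refine Finset.sum_pos' (fun i _ => ?_) ⟨k, Finset.mem_univ _, ?_⟩
  · have := (e i).2
    nlinarith [mul_nonneg this.le (mul_self_nonneg (x i))]
  · have := (e k).2
    have h5 : 0 < x k * x k := mul_self_pos.mpr hk
    nlinarith [mul_pos this h5]

/-- $C$ carries a positive definite subspace of the pulled-back form to one of $A$; no invertibility
or squareness is needed. -/
theorem posIdx_congr_le {A : Matrix ι ι ℝ} (hA : A.IsHermitian) (C : Matrix ι κ ℝ) :
    posIdx (Cᵀ * A * C) ≤ posIdx A := by
  have hB : (Cᵀ * A * C).IsHermitian := by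
    rw [isHermitian_iff_transpose] at *
    simp [hA, Matrix.mul_assoc]
  obtain ⟨D, hD⟩ := exists_posDef_card_eq_posIdx hB
  have := card_le_posIdx_of_posDef hA (C * D) (by simpa [Matrix.mul_assoc] using hD)
  simpa using this

/-- **Sylvester's law of inertia.** -/
theorem posIdx_congr {A : Matrix ι ι ℝ} (hA : A.IsHermitian) {S : Matrix ι ι ℝ}
    (hS : IsUnit S.det) : posIdx (Sᵀ * A * S) = posIdx A := by
  refine le_antisymm (posIdx_congr_le hA S) ?_
  have hB : (Sᵀ * A * S).IsHermitian := by
    rw [isHermitian_iff_transpose] at *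
    simp [hA, Matrix.mul_assoc]
  have := posIdx_congr_le hB S⁻¹
  have e : (S⁻¹)ᵀ * (Sᵀ * A * S) * S⁻¹ = A := by
    have h1 : (S⁻¹)ᵀ * Sᵀ = 1 := by
      rw [← transpose_mul, Matrix.mul_nonsing_inv _ hS, transpose_one]
    calc (S⁻¹)ᵀ * (Sᵀ * A * S) * S⁻¹ = ((S⁻¹)ᵀ * Sᵀ) * A * (S * S⁻¹) := by
          simp only [Matrix.mul_assoc]
      _ = A := by rw [h1, Matrix.mul_nonsing_inv _ hS]; simp
  rwa [e] at this

theorem posIdx_fromBlocks_diag (A : Matrix ι ι ℝ) (D : Matrix κ κ ℝ) :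
    posIdx (fromBlocks A 0 0 D) = posIdx A + posIdx D := by
  rw [posIdx, charpoly_fromBlocks_zero₁₂, Polynomial.roots_mul
    (mul_ne_zero (charpoly_monic A).ne_zero (charpoly_monic D).ne_zero), Multiset.filter_add,
    Multiset.card_add]
  rfl

theorem posIdx_zero : posIdx (0 : Matrix ι ι ℝ) = 0 := by
  rw [posIdx, charpoly_zero, Polynomial.roots_X_pow, Multiset.card_eq_zero, Multiset.filter_eq_nil]
  intro a ha
  have := Multiset.mem_of_mem_nsmul ha
  simp only [Multiset.mem_singleton] at this
  simp [this]

/-- If $AD=0$ then $(x-A)(x-D)=x(x-A-D)$, so up to zeros the eigenvalues of $A+D$ are those of $A$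
and $D$ together. -/
theorem posIdx_add_of_mul_eq_zero {A D : Matrix ι ι ℝ} (h : A * D = 0) :
    posIdx (A + D) = posIdx A + posIdx D := by
  have key : (A + D).charpoly * (Polynomial.X : Polynomial ℝ) ^ Fintype.card ι =
      A.charpoly * D.charpoly := by
    rw [← charpoly_zero (R := ℝ) (n := ι)]
    simp only [charpoly, ← det_mul]
    congr 1
    have h' : A.map Polynomial.C * D.map Polynomial.C = (0 : Matrix ι ι (Polynomial ℝ)) := by
      rw [← Matrix.map_mul, h]; simp
    have h0 : (0 : Matrix ι ι ℝ).map (Polynomial.C : ℝ →+* Polynomial ℝ) = 0 := by ext; simp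
    simp only [charmatrix, h0, RingHom.mapMatrix_apply, sub_zero, Matrix.sub_mul,
      Matrix.mul_sub, h']
    have e : (A + D).map (Polynomial.C : ℝ →+* Polynomial ℝ) =
      A.map Polynomial.C + D.map Polynomial.C := by ext; simp
    rw [e, Matrix.add_mul]
    have c : A.map Polynomial.C * scalar ι (Polynomial.X : Polynomial ℝ) =
        scalar ι (Polynomial.X : Polynomial ℝ) * A.map Polynomial.C :=
      (scalar_comm _ (fun r => Commute.all _ _) _).symm
    have c' : D.map Polynomial.C * scalar ι (Polynomial.X : Polynomial ℝ) =
        scalar ι (Polynomial.X : Polynomial ℝ) * D.map Polynomial.C :=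
      (scalar_comm _ (fun r => Commute.all _ _) _).symm
    simp only [c, c']
    abel
  have h2 := congrArg (fun p : Polynomial ℝ => (p.roots.filter fun x => 0 < x).card) key
  rw [Polynomial.roots_mul (mul_ne_zero (charpoly_monic _).ne_zero (by simp)), Polynomial.roots_mul
    (mul_ne_zero (charpoly_monic A).ne_zero (charpoly_monic D).ne_zero), Multiset.filter_add,
    Multiset.filter_add, Multiset.card_add, Multiset.card_add, ← charpoly_zero (R := ℝ) (n := ι)]
    at h2
  have h3 := posIdx_zero (ι := ι)
  unfold posIdx at *
  omega

theorem posIdx_transpose_mul_self (N : Matrix ι ι ℝ) : posIdx (Nᵀ * N) = N.rank := by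
  have h : (Nᵀ * N).IsHermitian := by rw [isHermitian_iff_transpose]; simp
  have h1 := posIdx_add_posIdx_neg h
  have h2 : posIdx (-(Nᵀ * N)) = 0 := by
    obtain ⟨C, hC⟩ := exists_posDef_card_eq_posIdx h.neg
    by_contra hne
    -- Any nonzero test vector will do; the constant vector $1$ is nonzero because its index set is
    -- nonempty.
    have hx := hC (fun _ => 1) fun h0 => one_ne_zero (congrFun h0 ⟨0, Nat.pos_of_ne_zero hne⟩)
    have e : Cᵀ * -(Nᵀ * N) * C = -((N * C)ᵀ * (N * C)) := by simp [Matrix.mul_assoc]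
    rw [e, neg_mulVec, dotProduct_neg, ← mulVec_mulVec, dotProduct_mulVec, vecMul_transpose] at hx
    have : ∀ v : ι → ℝ, 0 ≤ v ⬝ᵥ v := fun v => Finset.sum_nonneg fun i _ => mul_self_nonneg _
    linarith [this ((N * C) *ᵥ fun _ => 1)]
  rw [rank_transpose_mul_self] at h1
  omega

theorem rank_fromBlocks_antidiag (N : Matrix ι ι ℝ) :
    (fromBlocks 0 N Nᵀ 0).rank = 2 * N.rank := by
  rw [← rank_transpose_mul_self, fromBlocks_transpose, fromBlocks_multiply]
  simp only [transpose_transpose, transpose_zero, Matrix.zero_mul, Matrix.mul_zero, add_zero,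
    zero_add]
  have e : fromBlocks (N * Nᵀ) 0 0 (Nᵀ * N) =
      (fromBlocks Nᵀ 0 0 N)ᵀ * fromBlocks Nᵀ 0 0 N := by
    rw [fromBlocks_transpose, fromBlocks_multiply]; simp
  have h := posIdx_transpose_mul_self (fromBlocks Nᵀ 0 0 N)
  rw [← e, posIdx_fromBlocks_diag, posIdx_transpose_mul_self] at h
  have h' := posIdx_transpose_mul_self Nᵀ
  rw [transpose_transpose, rank_transpose] at h'
  rw [e, rank_transpose_mul_self, ← h, h']
  ring

/-- Congruence by $\mathrm{diag}(1,-1)$ changes the sign of the form, so exactly half of its rank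
$2\operatorname{rank}N$ is positive. -/
theorem posIdx_fromBlocks_antidiag (N : Matrix ι ι ℝ) :
    posIdx (fromBlocks 0 N Nᵀ 0) = N.rank := by
  have hT : (fromBlocks 0 N Nᵀ 0).IsHermitian := by
    rw [isHermitian_iff_transpose, fromBlocks_transpose]; simp
  have h1 := posIdx_add_posIdx_neg hT
  have h2 : posIdx (-fromBlocks 0 N Nᵀ 0) = posIdx (fromBlocks 0 N Nᵀ 0) := by
    rw [← posIdx_congr hT (S := fromBlocks 1 0 0 (-1)) (by
      rw [det_fromBlocks_zero₁₂]; simp [det_neg])]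
    congr 1
    simp [fromBlocks_transpose, fromBlocks_multiply, fromBlocks_neg]
  rw [rank_fromBlocks_antidiag] at h1
  omega

/-! ### Semicontinuity of the inertia and continuity of ordered eigenvalues -/

section Continuity

variable {X : Type*}

/-- Positivity of $A_0$ on the compact unit sphere of a maximal positive definite subspace persists
under small perturbations. -/
theorem eventually_posIdx_ge {l : Filter X} {A : X → Matrix ι ι ℝ} {A₀ : Matrix ι ι ℝ}
    (hA₀ : A₀.IsHermitian) (hA : ∀ᶠ t in l, (A t).IsHermitian) (hl : Tendsto A l (𝓝 A₀)) :
    ∀ᶠ t in l, posIdx A₀ ≤ posIdx (A t) := by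
  obtain ⟨C, hC⟩ := exists_posDef_card_eq_posIdx hA₀
  have h1 : ∀ᶠ M : Matrix ι ι ℝ in 𝓝 A₀, ∀ x ∈ Metric.sphere (0 : Fin (posIdx A₀) → ℝ) 1,
      0 < x ⬝ᵥ ((Cᵀ * M * C) *ᵥ x) := by
    refine (isCompact_sphere _ _).eventually_forall_of_forall_eventually fun x hx => ?_
    have hc : Continuous fun p : Matrix ι ι ℝ × (Fin (posIdx A₀) → ℝ) =>
        p.2 ⬝ᵥ ((Cᵀ * p.1 * C) *ᵥ p.2) := by fun_prop
    refine (hc.tendsto (A₀, x)).eventually (lt_mem_nhds (hC x ?_))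
    rintro rfl
    simp at hx
  filter_upwards [hl.eventually h1, hA] with t ht hAt
  have := card_le_posIdx_of_posDef hAt C fun x hx => by
    have hn : 0 < ‖x‖ := norm_pos_iff.mpr hx
    have h2 := ht (‖x‖⁻¹ • x) (by simp [norm_smul, hn.ne'])
    rw [mulVec_smul, smul_dotProduct, dotProduct_smul, smul_smul] at h2
    exact pos_of_mul_pos_right h2 (by positivity)
  simpa using this

/-- The positive indices of $A$ and $-A$ can only jump up near $A_0$, while their sum is the fixed
rank. -/
theorem eventually_posIdx_eq_of_rank {l : Filter X} {A : X → Matrix ι ι ℝ} {A₀ : Matrix ι ι ℝ}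
    (hA₀ : A₀.IsHermitian) (hA : ∀ᶠ t in l, (A t).IsHermitian) (hl : Tendsto A l (𝓝 A₀))
    (hr : ∀ᶠ t in l, (A t).rank = A₀.rank) : ∀ᶠ t in l, posIdx (A t) = posIdx A₀ := by
  filter_upwards [eventually_posIdx_ge hA₀ hA hl,
    eventually_posIdx_ge hA₀.neg (hA.mono fun t h => h.neg) hl.neg, hr, hA] with t h1 h2 h3 h4
  have h5 := posIdx_add_posIdx_neg hA₀
  have h6 := posIdx_add_posIdx_neg h4
  omega

omit [DecidableEq ι] in
theorem lt_iff_val_lt_card_of_antitone {m : ℕ} {f : Fin m → ℝ} (hf : Antitone f) (k : Fin m) (x : ℝ) :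
    x < f k ↔ (k : ℕ) < Fintype.card {i // x < f i} := by
  rw [Fintype.card_subtype]
  constructor
  · intro h
    have : Finset.Iic k ⊆ Finset.univ.filter fun i => x < f i := fun i hi => by
      simp only [Finset.mem_filter, Finset.mem_univ, true_and]
      exact h.trans_le (hf (Finset.mem_Iic.mp hi))
    have := Finset.card_le_card this
    rw [Fin.card_Iic] at this
    omega
  · intro h
    by_contra hx
    have : (Finset.univ.filter fun i => x < f i) ⊆ Finset.Iio k := fun i hi => by
      simp only [Finset.mem_filter, Finset.mem_univ, true_and] at hi
      rw [Finset.mem_Iio]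
      by_contra hki
      exact hx (hi.trans_le (hf (not_lt.mp hki)))
    have := Finset.card_le_card this
    rw [Fin.card_Iio] at this
    omega

/-- Together with `eigenvalues₀_lt_iff`, this converts semicontinuity of the positive index into
continuity of each ordered eigenvalue. -/
theorem lt_eigenvalues₀_iff {A : Matrix ι ι ℝ} (hA : A.IsHermitian) (k : Fin (Fintype.card ι))
    (x : ℝ) : x < hA.eigenvalues₀ k ↔ (k : ℕ) < posIdx (A - x • 1) := by
  have h : (A - x • 1).charpoly.roots = A.charpoly.roots.map fun y => y - x := by
    obtain ⟨Q, h1, h2, h3⟩ := real_spectral hA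
    have e : A - x • 1 = Q * (diagonal fun i => hA.eigenvalues i - x) * Qᵀ := by
      have : (diagonal fun i => hA.eigenvalues i - x) =
          diagonal hA.eigenvalues - x • (1 : Matrix ι ι ℝ) := by
        rw [smul_one_eq_diagonal, diagonal_sub]
      rw [this, Matrix.mul_sub, Matrix.sub_mul, ← h3]
      simp [h2]
    rw [e, roots_charpoly_conj_diagonal h1, hA.roots_charpoly_eq_eigenvalues, Multiset.map_map]
    rfl
  rw [lt_iff_val_lt_card_of_antitone hA.eigenvalues₀_antitone, posIdx, h, hA.roots_charpoly_eq_eigenvalues₀,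
    Multiset.map_map, Multiset.filter_map, Multiset.card_map, Fintype.card_subtype, Finset.card_def,
    Finset.filter_val]
  simp [Function.comp_def]

theorem eigenvalues₀_lt_iff {A : Matrix ι ι ℝ} (hA : A.IsHermitian) (k : Fin (Fintype.card ι))
    (x : ℝ) : hA.eigenvalues₀ k < x ↔ Fintype.card ι ≤ k + posIdx (x • 1 - A) := by
  have h : (x • 1 - A).charpoly.roots = A.charpoly.roots.map fun y => x - y := by
    obtain ⟨Q, h1, h2, h3⟩ := real_spectral hA
    have e : x • 1 - A = Q * (diagonal fun i => x - hA.eigenvalues i) * Qᵀ := by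
      have : (diagonal fun i => x - hA.eigenvalues i) =
          x • (1 : Matrix ι ι ℝ) - diagonal hA.eigenvalues := by
        rw [smul_one_eq_diagonal, diagonal_sub]
      rw [this, Matrix.mul_sub, Matrix.sub_mul, ← h3]
      simp [h2]
    rw [e, roots_charpoly_conj_diagonal h1, hA.roots_charpoly_eq_eigenvalues, Multiset.map_map]
    rfl
  have h2 : posIdx (x • 1 - A) = Fintype.card {i // hA.eigenvalues₀ i < x} := by
    rw [posIdx, h, hA.roots_charpoly_eq_eigenvalues₀,
      Multiset.map_map, Multiset.filter_map, Multiset.card_map, Fintype.card_subtype,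
      Finset.card_def, Finset.filter_val]
    simp [Function.comp_def]
  -- Negating and reversing the order gives a decreasing sequence again, so the same counting lemma
  -- applies.
  have h3 := lt_iff_val_lt_card_of_antitone (f := fun i => -hA.eigenvalues₀ i.rev)
    (fun i j hij => neg_le_neg (hA.eigenvalues₀_antitone (Fin.rev_le_rev.mpr hij))) k.rev (-x)
  rw [Fin.rev_rev, neg_lt_neg_iff] at h3
  have h4 : Fintype.card {i : Fin (Fintype.card ι) // -x < -hA.eigenvalues₀ i.rev} =
      Fintype.card {i // hA.eigenvalues₀ i < x} :=
    Fintype.card_congr (Fin.revPerm.subtypeEquiv fun i => by simp)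
  rw [h3, h4, h2, Fin.val_rev]
  have := k.2
  omega

theorem continuousOn_eigenvalues₀ [TopologicalSpace X] {A : X → Matrix ι ι ℝ} {s : Set X}
    (hA : ContinuousOn A s) (hs : ∀ t ∈ s, (A t).IsHermitian) :
    ∃ β : Fin (Fintype.card ι) → X → ℝ, (∀ k, ContinuousOn (β k) s) ∧
      ∀ t ∈ s, (A t).charpoly.roots = Finset.univ.val.map fun k => β k t := by
  classical
  obtain ⟨β, hβ⟩ : ∃ β : Fin (Fintype.card ι) → X → ℝ,
      ∀ k t (ht : t ∈ s), β k t = (hs t ht).eigenvalues₀ k :=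
    ⟨fun k t => if h : t ∈ s then (hs t h).eigenvalues₀ k else 0, fun k t ht => dif_pos ht⟩
  refine ⟨β, fun k t ht => ?_, fun t ht => ?_⟩
  · have h1 : ∀ x : ℝ, (x • (1 : Matrix ι ι ℝ)).IsHermitian := fun x => by
      rw [isHermitian_iff_transpose]; simp
    refine tendsto_order.2 ⟨fun x hx => ?_, fun x hx => ?_⟩
    · rw [hβ k t ht, lt_eigenvalues₀_iff] at hx
      filter_upwards [self_mem_nhdsWithin, eventually_posIdx_ge (l := 𝓝[s] t)
        (A := fun t => A t - x • 1) ((hs t ht).sub (h1 x))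
        (by filter_upwards [self_mem_nhdsWithin] with u hu using (hs u hu).sub (h1 x))
        ((hA t ht).sub_const _)] with u hu h2
      rw [hβ k u hu, lt_eigenvalues₀_iff]
      exact hx.trans_le h2
    · rw [gt_iff_lt, hβ k t ht, eigenvalues₀_lt_iff] at hx
      filter_upwards [self_mem_nhdsWithin, eventually_posIdx_ge (l := 𝓝[s] t)
        (A := fun t => x • 1 - A t) ((h1 x).sub (hs t ht))
        (by filter_upwards [self_mem_nhdsWithin] with u hu using (h1 x).sub (hs u hu))
        ((hA t ht).const_sub _)] with u hu h2
      rw [hβ k u hu, eigenvalues₀_lt_iff]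
      omega
  · rw [(hs t ht).roots_charpoly_eq_eigenvalues₀]
    exact Multiset.map_congr rfl fun k _ => (hβ k t ht).symm

end Continuity

end Inertia

/-! ### The comparative index as an inertia -/

section ComparativeIndex

variable {n : ℕ}

theorem isMoorePenrose_pinv (A : Matrix (Fin n) (Fin n) ℝ) : IsMoorePenrose A (pinv A) :=
  (exists_isMoorePenrose A).choose_spec

/-- Inertia of a symmetric block matrix in terms of a generalized Schur complement. -/
theorem posIdx_fromBlocks_generalized_schur {b c d J N Np V : Matrix (Fin n) (Fin n) ℝ}
    (hb : bᵀ = b) (hd : dᵀ = d) (hc : c = b * J + N) (hbN : b * N = 0)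
    (hN : IsMoorePenrose N Np) (hV : V = 1 - Np * N) :
    posIdx (fromBlocks b c cᵀ d) = posIdx b + N.rank + posIdx (V * (d - Jᵀ * b * J) * V) := by
  obtain ⟨h1, h2, h3, h4⟩ := hN
  have hNV : N * V = 0 := by rw [hV, Matrix.mul_sub, ← Matrix.mul_assoc, h1]; simp
  have hVt : Vᵀ = V := by rw [hV, transpose_sub, h4, transpose_one]
  have hVN : V * Nᵀ = 0 := by
    have := congrArg transpose hNV
    rwa [transpose_mul, hVt, transpose_zero] at this
  set D := d - Jᵀ * b * J - Nᵀ * J - Jᵀ * N with hD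
  have hDt : Dᵀ = D := by
    rw [hD]
    simp only [transpose_sub, transpose_mul, hb, hd, transpose_transpose, Matrix.mul_assoc]
    abel
  have hNpN : Npᵀ = N * Np * Npᵀ := by
    conv_lhs => rw [← h2, Matrix.mul_assoc, transpose_mul, h3]
  have hbNp : b * Npᵀ = 0 := by
    rw [hNpN, ← Matrix.mul_assoc, ← Matrix.mul_assoc, hbN]; simp
  have h4' : Nᵀ * Npᵀ = Np * N := by rw [← transpose_mul, h4]
  -- Solves $D-N^TY-Y^TN=VDV$ with $bY=0$. Since $p=N^\dagger N$ gives $VDV=D-pD-Dp+pDp$, the term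
  -- $pDp$ is shared equally between the two products, whence the factor $1/2$.
  set Y := Npᵀ * D - (1 / 2 : ℝ) • (Npᵀ * D * (Np * N)) with hY
  have hbY : b * Y = 0 := by
    rw [hY, Matrix.mul_sub, Matrix.mul_smul, Matrix.mul_assoc Npᵀ, ← Matrix.mul_assoc b,
      ← Matrix.mul_assoc b, hbNp]
    simp
  have hYt : Yᵀ = D * Np - (1 / 2 : ℝ) • (Np * N * D * Np) := by
    rw [hY, transpose_sub, transpose_smul, transpose_mul _ (Np * N), h4, transpose_mul, hDt,
      transpose_transpose, ← Matrix.mul_assoc]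
  have hYb : Yᵀ * b = 0 := by
    have := congrArg transpose hbY
    rwa [transpose_mul, hb, transpose_zero] at this
  have hVDV : D - Nᵀ * Y - Yᵀ * N = V * (d - Jᵀ * b * J) * V := by
    have e1 : V * (d - Jᵀ * b * J) * V = V * D * V := by
      have : d - Jᵀ * b * J = D + Nᵀ * J + Jᵀ * N := by rw [hD]; abel
      rw [this, Matrix.mul_add, Matrix.mul_add, ← Matrix.mul_assoc V Nᵀ, hVN, Matrix.add_mul,
        Matrix.add_mul, Matrix.mul_assoc V (Jᵀ * N), Matrix.mul_assoc Jᵀ, hNV]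
      simp
    have e2 : Nᵀ * Y = Np * N * D - (1 / 2 : ℝ) • (Np * N * D * (Np * N)) := by
      rw [hY, Matrix.mul_sub, Matrix.mul_smul, ← h4']
      simp only [Matrix.mul_assoc]
    have e3 : Yᵀ * N = D * (Np * N) - (1 / 2 : ℝ) • (Np * N * D * (Np * N)) := by
      rw [hYt, Matrix.sub_mul, Matrix.smul_mul]
      simp only [Matrix.mul_assoc]
    rw [e1, e2, e3, hV]
    clear_value D
    generalize Np * N = p
    have : ∀ q : Matrix (Fin n) (Fin n) ℝ, q = (1 / 2 : ℝ) • q + (1 / 2 : ℝ) • q := fun q => by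
      rw [← add_smul]; norm_num
    rw [Matrix.sub_mul, Matrix.mul_sub, Matrix.sub_mul, Matrix.mul_one, Matrix.one_mul, Matrix.mul_one,
      Matrix.sub_mul]
    conv_rhs => rw [this (p * D * p)]
    abel
  have hH : (fromBlocks b c cᵀ d).IsHermitian := by
    rw [isHermitian_iff_transpose, fromBlocks_transpose, hb, hd, transpose_transpose]
  -- Subtracting $J$ removes $bJ$ from the off-diagonal block, and $Y$ clears from the corner all
  -- that $N$ can reach. The two summands multiply to zero, so their positive indices add.
  have step : (fromBlocks 1 (-(J + Y)) 0 1)ᵀ * fromBlocks b c cᵀ d * fromBlocks 1 (-(J + Y)) 0 1 =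
      fromBlocks b 0 0 (V * (d - Jᵀ * b * J) * V) + fromBlocks 0 N Nᵀ 0 := by
    have u1 : c - b * (J + Y) = N := by rw [Matrix.mul_add, hbY, hc]; abel
    have u2 : cᵀ - (J + Y)ᵀ * b = Nᵀ := by
      rw [← u1, transpose_sub, transpose_mul, hb]
    have u3 : d - (J + Y)ᵀ * c - Nᵀ * (J + Y) = V * (d - Jᵀ * b * J) * V := by
      rw [← hVDV, hD, hc, transpose_add, Matrix.add_mul, Matrix.mul_add Jᵀ, Matrix.mul_add Yᵀ,
        ← Matrix.mul_assoc Yᵀ b, hYb, Matrix.mul_add, Matrix.zero_mul, ← Matrix.mul_assoc Jᵀ b]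
      abel
    rw [fromBlocks_transpose, fromBlocks_multiply, fromBlocks_multiply, fromBlocks_add]
    simp only [transpose_one, transpose_zero, transpose_neg, Matrix.one_mul, Matrix.mul_one,
      Matrix.zero_mul, Matrix.mul_zero, add_zero, zero_add, Matrix.neg_mul, Matrix.mul_neg]
    rw [neg_add_eq_sub _ c, neg_add_eq_sub _ cᵀ, neg_add_eq_sub _ d, neg_add_eq_sub, u1, u2, u3]
  rw [← posIdx_congr hH (S := fromBlocks 1 (-(J + Y)) 0 1)
    (by rw [det_fromBlocks_zero₂₁]; simp), step, posIdx_add_of_mul_eq_zero,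
    posIdx_fromBlocks_diag, posIdx_fromBlocks_antidiag]
  · ring
  · rw [fromBlocks_multiply]
    simp [hbN, Matrix.mul_assoc, hVN]

/-- Data expressing a pair of frames in coordinates in which the vertical plane is the graph of
`0` and the two frames span the graphs of the symmetric matrices `B` and `C`. -/
structure GraphPair (F Fh : Frame n) (B C G H : Matrix (Fin n) (Fin n) ℝ) : Prop where
  symmB : Bᵀ = B
  symmC : Cᵀ = C
  unitG : IsUnit G.det
  unitH : IsUnit H.det
  upper : F.toRows₁ = B * G
  upper' : Fh.toRows₁ = C * H
  wronskian_eq : wronskian F Fh = Gᵀ * (C - B) * H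

namespace GraphPair

variable {F Fh : Frame n} {B C G H : Matrix (Fin n) (Fin n) ℝ}

/-- The $B$-part of the Wronskian is $X^TH$, and $I-X^\dagger X$ annihilates $X^T$. -/
theorem compM_eq (h : GraphPair F Fh B C G H) :
    compM F Fh = (1 - pinv F.toRows₁ * F.toRows₁) * (Gᵀ * C * H) := by
  obtain ⟨h1, -, -, h4⟩ := isMoorePenrose_pinv F.toRows₁
  have e : (1 - pinv F.toRows₁ * F.toRows₁) * (F.toRows₁)ᵀ = 0 := by
    have := congrArg transpose h1
    rw [Matrix.mul_assoc, transpose_mul, h4] at this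
    rw [Matrix.sub_mul, this]; simp
  have hX : F.toRows₁ᵀ = Gᵀ * B := by rw [h.upper, transpose_mul, h.symmB]
  rw [compM, h.wronskian_eq, Matrix.mul_sub Gᵀ, Matrix.sub_mul (Gᵀ * C), ← hX, Matrix.mul_sub,
    ← Matrix.mul_assoc _ (F.toRows₁)ᵀ, e]
  simp

theorem compM_mul_compV : compM F Fh * compV F Fh = 0 := by
  obtain ⟨h1, -, -, -⟩ := isMoorePenrose_pinv (compM F Fh)
  rw [compV, Matrix.mul_sub, ← Matrix.mul_assoc, h1]; simp

theorem compV_transpose : (compV F Fh)ᵀ = compV F Fh := by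
  obtain ⟨-, -, -, h4⟩ := isMoorePenrose_pinv (compM F Fh)
  rw [compV, transpose_sub, h4, transpose_one]

/-- From $\mathcal MV=0$ and $X^\dagger X=G^TB(X^\dagger)^T$, cancelling $G^T$ puts the columns of
$\hat XV$ in the column space of $X$. -/
theorem mul_compV (h : GraphPair F Fh B C G H) :
    Fh.toRows₁ * compV F Fh =
      F.toRows₁ * (G⁻¹ * (pinv F.toRows₁)ᵀ * (Gᵀ * C * H)) * compV F Fh := by
  obtain ⟨-, -, -, h4⟩ := isMoorePenrose_pinv F.toRows₁
  have e := compM_mul_compV (F := F) (Fh := Fh)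
  rw [h.compM_eq, Matrix.mul_assoc, Matrix.sub_mul, Matrix.one_mul, sub_eq_zero] at e
  have hGt : IsUnit Gᵀ.det := by rw [det_transpose]; exact h.unitG
  have hX : F.toRows₁ᵀ = Gᵀ * B := by rw [h.upper, transpose_mul, h.symmB]
  rw [← h4, transpose_mul, hX] at e
  have e2 := congrArg (fun M => Gᵀ⁻¹ * M) e
  simp only [Matrix.mul_assoc, nonsing_inv_mul_cancel_left _ _ hGt] at e2
  have e3 : F.toRows₁ * G⁻¹ = B := by rw [h.upper, mul_nonsing_inv_cancel_right _ _ h.unitG]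
  rw [h.upper', Matrix.mul_assoc, e2, ← e3]
  simp only [Matrix.mul_assoc]

theorem pinv_mul_compV (h : GraphPair F Fh B C G H) :
    F.toRows₁ * pinv F.toRows₁ * Fh.toRows₁ * compV F Fh = Fh.toRows₁ * compV F Fh := by
  obtain ⟨h1, -, -, -⟩ := isMoorePenrose_pinv F.toRows₁
  rw [Matrix.mul_assoc _ _ (compV F Fh), h.mul_compV, ← Matrix.mul_assoc, ← Matrix.mul_assoc, h1]

/-- The comparative index in graph coordinates. -/
theorem compIndex_add_posIdx (h : GraphPair F Fh B C G H) :
    compIndex F Fh + posIdx B = posIdx C + posIdx (B - C) := by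
  obtain ⟨h1, h2, h3, h4⟩ := isMoorePenrose_pinv F.toRows₁
  have hB := h.symmB
  have hC := h.symmC
  have hX : F.toRows₁ᵀ = Gᵀ * B := by rw [h.upper, transpose_mul, h.symmB]
  set Xp := pinv F.toRows₁ with hXp
  set c := Gᵀ * C * H with hc
  set b := Gᵀ * B * G with hb
  set d := Hᵀ * C * H with hd
  set J := G⁻¹ * Xpᵀ * c with hJ
  set N := compM F Fh with hN
  set V := compV F Fh with hV
  have hNe : N = (1 - Xp * F.toRows₁) * c := h.compM_eq
  have hNV : N * V = 0 := compM_mul_compV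
  have hVt : Vᵀ = V := compV_transpose
  have hVN : V * Nᵀ = 0 := by
    have := congrArg transpose hNV
    rwa [transpose_mul, hVt, transpose_zero] at this
  have hbX : b = Gᵀ * F.toRows₁ := by rw [hb, h.upper, Matrix.mul_assoc]
  have hbt : bᵀ = b := by rw [hb]; simp [hB, Matrix.mul_assoc]
  have hdt : dᵀ = d := by rw [hd]; simp [hC, Matrix.mul_assoc]
  have hbJ : b * J = Xp * F.toRows₁ * c := by
    rw [hJ, hb, ← h4, transpose_mul, hX]
    calc Gᵀ * B * G * (G⁻¹ * Xpᵀ * c) = Gᵀ * B * (G * (G⁻¹ * (Xpᵀ * c))) := by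
          simp only [Matrix.mul_assoc]
      _ = _ := by rw [mul_nonsing_inv_cancel_left _ _ h.unitG]; simp only [Matrix.mul_assoc]
  have hcJ : c = b * J + N := by rw [hbJ, hNe, Matrix.sub_mul, Matrix.one_mul]; abel
  have hbN : b * N = 0 := by
    rw [hNe, hbX, Matrix.sub_mul, Matrix.one_mul, Matrix.mul_sub]
    have : Gᵀ * F.toRows₁ * (Xp * F.toRows₁ * c) = Gᵀ * (F.toRows₁ * Xp * F.toRows₁) * c := by
      simp only [Matrix.mul_assoc]
    rw [this, h1, sub_self]
  -- First evaluation of the inertia of the block form $(b,c;c^T,d)$, by generalized Schur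
  -- complement; here $N$ is $\mathcal M$ itself.
  have key := posIdx_fromBlocks_generalized_schur hbt hdt hcJ hbN (isMoorePenrose_pinv N) rfl
  -- The Schur complement is $-\mathcal P$, so negative eigenvalues of $\mathcal P$ are counted as
  -- positive ones.
  have hP : V * (d - Jᵀ * b * J) * V = -compP F Fh := by
    have hW : (wronskian F Fh)ᵀ = cᵀ - Hᵀ * F.toRows₁ := by
      rw [h.wronskian_eq, Matrix.mul_sub, Matrix.sub_mul, transpose_sub, ← hX]
      simp [hc]
    have hCV : Fh.toRows₁ * V = F.toRows₁ * J * V := h.mul_compV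
    have e1 : V * cᵀ * Xp * Fh.toRows₁ * V = V * (Jᵀ * b * J) * V := by
      have : V * cᵀ = V * Jᵀ * b := by
        rw [hcJ, transpose_add, Matrix.mul_add, hVN, transpose_mul, hbt, add_zero,
          Matrix.mul_assoc]
      rw [Matrix.mul_assoc _ _ V, hCV, this, hbX]
      calc V * Jᵀ * (Gᵀ * F.toRows₁) * Xp * (F.toRows₁ * J * V)
          = V * Jᵀ * Gᵀ * (F.toRows₁ * Xp * F.toRows₁) * J * V := by simp only [Matrix.mul_assoc]
        _ = _ := by rw [h1]; simp only [Matrix.mul_assoc]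
    have e2 : V * (Hᵀ * F.toRows₁) * Xp * Fh.toRows₁ * V = V * d * V := by
      calc V * (Hᵀ * F.toRows₁) * Xp * Fh.toRows₁ * V
          = V * Hᵀ * (F.toRows₁ * Xp * Fh.toRows₁ * V) := by simp only [Matrix.mul_assoc]
        _ = V * Hᵀ * (Fh.toRows₁ * V) := by rw [h.pinv_mul_compV]
        _ = _ := by rw [h.upper', hd]; simp only [Matrix.mul_assoc]
    have e3 : compP F Fh = V * cᵀ * Xp * Fh.toRows₁ * V -
        V * (Hᵀ * F.toRows₁) * Xp * Fh.toRows₁ * V := by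
      rw [compP, hW, Matrix.mul_sub]
      simp only [Matrix.sub_mul]
      rfl
    rw [e3, e1, e2, Matrix.mul_sub, Matrix.sub_mul]
    abel
  have hPt : (compP F Fh).IsHermitian := by
    have : compP F Fh = -(V * (d - Jᵀ * b * J) * V) := by rw [hP, neg_neg]
    rw [isHermitian_iff_transpose, this]
    simp [hVt, hdt, hbt, Matrix.mul_assoc]
  have hneg : negIndex (compP F Fh) = posIdx (-compP F Fh) := card_filter_neg_eq_posIdx_neg hPt
  have hb' : posIdx b = posIdx B := posIdx_congr (isHermitian_iff_transpose.mpr hB) h.unitG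
  -- Second evaluation: the same form is congruent to $\mathrm{diag}(B-C,C)$.
  have hBC : posIdx (fromBlocks b c cᵀ d) = posIdx (B - C) + posIdx C := by
    have hs : (fromBlocks (B - C) 0 0 C).IsHermitian := by
      rw [isHermitian_iff_transpose, fromBlocks_transpose, transpose_sub, hB, hC]; simp
    rw [← posIdx_fromBlocks_diag, ← posIdx_congr hs (S := fromBlocks G 0 G H)
      (by rw [det_fromBlocks_zero₁₂]; exact h.unitG.mul h.unitH)]
    congr 1
    rw [fromBlocks_transpose, fromBlocks_multiply, fromBlocks_multiply]
    simp only [transpose_zero, Matrix.zero_mul, Matrix.mul_zero, add_zero, zero_add]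
    rw [hb, hc, hd]
    congr 1
    · rw [← Matrix.add_mul, ← Matrix.mul_add, sub_add_cancel]
    · simp [hC, Matrix.mul_assoc]
  rw [compIndex, hneg, ← hP]
  rw [hBC, hb'] at key
  change posIdx (B - C) + posIdx C =
    posIdx B + N.rank + posIdx (V * (d - Jᵀ * b * J) * V) at key
  have hNr : N.rank = (compM F Fh).rank := rfl
  omega

end GraphPair

/-- The comparative index is invariant under symplectic changes of coordinates which preserve the
vertical plane: only the upper blocks and the Wronskian matter. -/
theorem compIndex_congr {F Fh F' Fh' : Frame n} {a : Matrix (Fin n) (Fin n) ℝ} (ha : IsUnit a.det)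
    (h1 : F'.toRows₁ = a * F.toRows₁) (h2 : Fh'.toRows₁ = a * Fh.toRows₁)
    (hW : wronskian F' Fh' = wronskian F Fh)
    (hV : F.toRows₁ * pinv F.toRows₁ * Fh.toRows₁ * compV F Fh = Fh.toRows₁ * compV F Fh) :
    compIndex F' Fh' = compIndex F Fh := by
  obtain ⟨x1, x2, -, x4⟩ := isMoorePenrose_pinv F.toRows₁
  obtain ⟨y1, y2, -, y4⟩ := isMoorePenrose_pinv F'.toRows₁
  have hp : pinv F'.toRows₁ * F'.toRows₁ = pinv F.toRows₁ * F.toRows₁ := by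
    have e1 : F.toRows₁ * (pinv F'.toRows₁ * F'.toRows₁) = F.toRows₁ := by
      have := congrArg (fun M => a⁻¹ * M) y1
      rw [Matrix.mul_assoc] at this
      nth_rw 1 [h1] at this
      nth_rw 3 [h1] at this
      rwa [Matrix.mul_assoc, nonsing_inv_mul_cancel_left _ _ ha,
        nonsing_inv_mul_cancel_left _ _ ha] at this
    have e2 : F'.toRows₁ * (pinv F.toRows₁ * F.toRows₁) = F'.toRows₁ := by
      rw [h1, Matrix.mul_assoc, ← Matrix.mul_assoc F.toRows₁, x1]
    have e3 : pinv F.toRows₁ * F.toRows₁ * (pinv F'.toRows₁ * F'.toRows₁) =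
        pinv F.toRows₁ * F.toRows₁ := by rw [Matrix.mul_assoc, e1]
    have e4 : pinv F'.toRows₁ * F'.toRows₁ * (pinv F.toRows₁ * F.toRows₁) =
        pinv F'.toRows₁ * F'.toRows₁ := by rw [Matrix.mul_assoc, e2]
    have e5 := congrArg transpose e3
    rw [transpose_mul, x4, y4, e4] at e5
    exact e5
  have hM : compM F' Fh' = compM F Fh := by rw [compM, compM, hp, hW]
  have hVV : compV F' Fh' = compV F Fh := by rw [compV, compV, hM]
  -- In general $(aX)^\dagger\neq X^\dagger a^{-1}$, but only $\hat XV=XX^\dagger\hat XV$ enters, so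
  -- $(aX)^\dagger$ meets only $aX$, and the row-space projection $X^\dagger X$ is unchanged.
  have hP : compP F' Fh' = compP F Fh := by
    rw [compP, compP, hVV, hW, Matrix.mul_assoc _ Fh'.toRows₁, h2, Matrix.mul_assoc a, ← hV]
    calc compV F Fh * (wronskian F Fh)ᵀ * pinv F'.toRows₁ *
          (a * (F.toRows₁ * pinv F.toRows₁ * Fh.toRows₁ * compV F Fh))
        = compV F Fh * (wronskian F Fh)ᵀ * (pinv F'.toRows₁ *
          (a * F.toRows₁)) * pinv F.toRows₁ * Fh.toRows₁ * compV F Fh := by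
          simp only [Matrix.mul_assoc]
      _ = compV F Fh * (wronskian F Fh)ᵀ * (pinv F.toRows₁ * F.toRows₁ * pinv F.toRows₁) *
          Fh.toRows₁ * compV F Fh := by
          rw [← h1, hp]; simp only [Matrix.mul_assoc]
      _ = _ := by rw [x2]
  rw [compIndex, compIndex, hM, hP]

end ComparativeIndex

/-! ### Complexification of real matrices -/

section Complexification

set_option linter.unusedSectionVars false

variable {ι κ ν : Type*} [Fintype ι] [Fintype κ] [Fintype ν] [DecidableEq ι] [DecidableEq κ]

/-- The complexification of a real matrix. -/
noncomputable def toC (A : Matrix ι κ ℝ) : Matrix ι κ ℂ := A.map Complex.ofReal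

theorem toC_add (A B : Matrix ι κ ℝ) : toC (A + B) = toC A + toC B := by ext; simp [toC]

theorem toC_sub (A B : Matrix ι κ ℝ) : toC (A - B) = toC A - toC B := by ext; simp [toC]

theorem toC_neg (A : Matrix ι κ ℝ) : toC (-A) = -toC A := by ext; simp [toC]

theorem toC_smul (r : ℝ) (A : Matrix ι κ ℝ) : toC (r • A) = (r : ℂ) • toC A := by ext; simp [toC]

theorem toC_mul (A : Matrix ι κ ℝ) (B : Matrix κ ν ℝ) : toC (A * B) = toC A * toC B := by
  ext; simp [toC, Matrix.mul_apply]

theorem toC_transpose (A : Matrix ι κ ℝ) : toC Aᵀ = (toC A)ᵀ := rfl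

theorem toC_one : toC (1 : Matrix ι ι ℝ) = 1 := by
  ext i j; by_cases h : i = j <;> simp [toC, one_apply, h]

theorem toC_diagonal (d : ι → ℝ) : toC (diagonal d) = diagonal fun i => (d i : ℂ) := by
  ext i j; by_cases h : i = j <;> simp [toC, h]

theorem det_toC (A : Matrix ι ι ℝ) : (toC A).det = (A.det : ℂ) :=
  (RingHom.map_det Complex.ofRealHom A).symm

theorem isUnit_det_toC {A : Matrix ι ι ℝ} (h : IsUnit A.det) : IsUnit (toC A).det := by
  rw [det_toC]; simpa using h

end Complexification

/-! ### The angle belonging to an eigenvalue of the slope -/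

section Branch

open Complex

/-- For a frame in graph coordinates `κ X - U`, `X (κ X - U)⁻¹ = B`, the eigenvalue `x` of `B`
corresponds to the Lidskii angle `2 arg (1 - (κ + i) x)`. -/
noncomputable def branch (κ x : ℝ) : ℝ := 2 * arg (1 - (κ + I) * x)

theorem branch_mem_slitPlane (κ x : ℝ) : 1 - (κ + I) * x ∈ slitPlane := by
  rw [mem_slitPlane_iff]
  by_cases h : x = 0
  · left; simp [h]
  · right; simpa using h

theorem continuous_branch (κ : ℝ) : Continuous (branch κ) := by
  refine continuous_iff_continuousAt.2 fun x => ?_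
  exact continuousAt_const.mul ((continuousAt_arg (branch_mem_slitPlane κ x)).comp
    (f := fun x : ℝ => 1 - (κ + I) * (x : ℂ)) (by fun_prop))

/-- The number $1-(\kappa+i)x$ has imaginary part $-x$, so its argument is in $(-\pi,0)$ for $x>0$
and in $[0,\pi)$ otherwise. The value $\pi$ is excluded since $x=0$ gives the number $1$. -/
theorem windInt_branch (κ x : ℝ) : windInt (branch κ x) = if 0 < x then -1 else 0 := by
  have hpi := Real.pi_pos
  have e : branch κ x / (2 * Real.pi) = arg (1 - (κ + I) * x) / Real.pi := by
    rw [branch]; field_simp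
  have him : (1 - (κ + I) * x : ℂ).im = -x := by simp
  rw [windInt, e]
  split_ifs with h
  · rw [Int.floor_eq_iff]
    have h1 : arg (1 - (κ + I) * x) < 0 := by rw [arg_neg_iff, him]; linarith
    have h2 := neg_pi_lt_arg (1 - (κ + I) * x)
    constructor
    · rw [le_div_iff₀ hpi]; push_cast; linarith
    · rw [div_lt_iff₀ hpi]; push_cast; linarith
  · rw [Int.floor_eq_iff]
    have h1 : 0 ≤ arg (1 - (κ + I) * x) := by rw [arg_nonneg_iff, him]; linarith
    have h2 := (mem_slitPlane_iff_arg.1 (branch_mem_slitPlane κ x)).1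
    have h3 := lt_of_le_of_ne (arg_le_pi _) h2
    constructor
    · rw [le_div_iff₀ hpi]; push_cast; linarith
    · rw [div_lt_iff₀ hpi]; push_cast; linarith

/-- With $z=1-(\kappa+i)x$ this is $\bar z\,e^{2i\arg z}=z$, up to sign. -/
theorem mul_exp_branch (κ x : ℝ) :
    ((κ - I) * x - 1) * exp (I * branch κ x) = (κ + I) * x - 1 := by
  set z : ℂ := 1 - (κ + I) * x with hz
  have h1 : (‖z‖ : ℂ) * exp (arg z * I) = z := norm_mul_exp_arg_mul_I z
  have h2 : (κ - I) * x - 1 = -((starRingEnd ℂ) z) := by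
    simp [hz, sub_eq_add_neg]
  have h3 : (starRingEnd ℂ) z = (‖z‖ : ℂ) * exp (-(arg z * I)) := by
    conv_lhs => rw [← h1]
    rw [map_mul, ← Complex.exp_conj]
    simp
  have h4 : exp (I * branch κ x) = exp (arg z * I) * exp (arg z * I) := by
    rw [← exp_add, branch]; congr 1; push_cast; ring
  have h5 : exp (-(arg z * I)) * exp (arg z * I) = 1 := by rw [← exp_add]; simp
  have h6 : (κ + I) * x - 1 = -z := by rw [hz]; ring
  rw [h2, h3, h4, h6]
  conv_rhs => rw [← h1]
  linear_combination -(‖z‖ : ℂ) * exp (arg z * I) * h5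

end Branch

/-! ### Lagrangian frames, their phase and slope -/

section Frames

open Complex

variable {n : ℕ}

theorem wronskian_eq_sub (F Fh : Frame n) :
    wronskian F Fh = F.toRows₁ᵀ * Fh.toRows₂ - F.toRows₂ᵀ * Fh.toRows₁ := by
  conv_lhs => rw [wronskian, ← fromRows_toRows F, ← fromRows_toRows Fh]
  rw [calJ, transpose_fromRows, fromCols_mul_fromBlocks, fromCols_mul_fromRows]
  simp [sub_eq_add_neg, add_comm]

theorem IsLagrangian.comm {F : Frame n} (h : IsLagrangian F) :
    F.toRows₁ᵀ * F.toRows₂ = F.toRows₂ᵀ * F.toRows₁ := by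
  have := wronskian_eq_sub F F
  rw [wronskian, h.1] at this
  exact sub_eq_zero.mp this.symm

theorem gram_eq (F : Frame n) :
    Fᵀ * F = F.toRows₁ᵀ * F.toRows₁ + F.toRows₂ᵀ * F.toRows₂ := by
  conv_lhs => rw [← fromRows_toRows F]
  rw [transpose_fromRows, fromCols_mul_fromRows]

theorem isUnit_det_of_rank_eq {A : Matrix (Fin n) (Fin n) ℝ} (h : A.rank = n) : IsUnit A.det := by
  rw [← Matrix.isUnit_iff_isUnit_det, ← Matrix.mulVec_surjective_iff_isUnit]
  have : LinearMap.range A.mulVecLin = ⊤ :=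
    Submodule.eq_top_of_finrank_eq (by simpa [Matrix.rank] using h)
  exact LinearMap.range_eq_top.mp this

theorem IsLagrangian.isUnit_gram {F : Frame n} (h : IsLagrangian F) : IsUnit (Fᵀ * F).det :=
  isUnit_det_of_rank_eq (by rw [rank_transpose_mul_self, h.2])

/-- Symmetry of $X^TU$ cancels the cross terms in $(U^T+iX^T)(U-iX)$ and leaves the invertible Gram
matrix. -/
theorem IsLagrangian.isUnit_sub {F : Frame n} (h : IsLagrangian F) :
    IsUnit (toC F.toRows₂ - I • toC F.toRows₁).det := by
  have e : (toC F.toRows₂ᵀ + I • toC F.toRows₁ᵀ) * (toC F.toRows₂ - I • toC F.toRows₁) =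
      toC (Fᵀ * F) := by
    rw [gram_eq, toC_add, Matrix.add_mul, Matrix.mul_sub, Matrix.mul_sub]
    simp only [Matrix.smul_mul, Matrix.mul_smul, smul_smul, I_mul_I, ← toC_mul, ← h.comm]
    module
  have h2 := isUnit_det_toC h.isUnit_gram
  rw [← e, det_mul] at h2
  exact isUnit_of_mul_isUnit_right h2

theorem IsLagrangian.isUnit_add {F : Frame n} (h : IsLagrangian F) :
    IsUnit (toC F.toRows₂ + I • toC F.toRows₁).det := by
  have e : (toC F.toRows₂ᵀ - I • toC F.toRows₁ᵀ) * (toC F.toRows₂ + I • toC F.toRows₁) =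
      toC (Fᵀ * F) := by
    rw [gram_eq, toC_add, Matrix.sub_mul, Matrix.mul_add, Matrix.mul_add]
    simp only [Matrix.smul_mul, Matrix.mul_smul, smul_smul, I_mul_I, ← toC_mul, ← h.comm]
    module
  have h2 := isUnit_det_toC h.isUnit_gram
  rw [← e, det_mul] at h2
  exact isUnit_of_mul_isUnit_right h2

/-- The unitary-type matrix `(U - iX)⁻¹ (U + iX)` of a Lagrangian frame, whose eigenvalue `1`
detects the intersection with the vertical plane. -/
noncomputable def phase (F : Frame n) : Matrix (Fin n) (Fin n) ℂ :=
  (toC F.toRows₂ - I • toC F.toRows₁)⁻¹ * (toC F.toRows₂ + I • toC F.toRows₁)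

/-- The matrix `κ X - U`, invertible if the frame is transversal to the graph of `κ`. -/
noncomputable def tilt (κ : ℝ) (F : Frame n) : Matrix (Fin n) (Fin n) ℝ :=
  κ • F.toRows₁ - F.toRows₂

/-- The symmetric matrix `X (κ X - U)⁻¹`. -/
noncomputable def slope (κ : ℝ) (F : Frame n) : Matrix (Fin n) (Fin n) ℝ :=
  F.toRows₁ * (tilt κ F)⁻¹

/-- The polynomial $\det(\kappa X-U)$ is nonzero because at $\kappa=i$ it is $\pm\det(U-iX)$. Hence
only finitely many $\kappa$ are bad for a given frame, and two frames share a good one. -/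
theorem IsLagrangian.exists_polynomial {F : Frame n} (h : IsLagrangian F) :
    ∃ p : Polynomial ℝ, p ≠ 0 ∧ ∀ κ, p.eval κ = (tilt κ F).det := by
  refine ⟨((Polynomial.X : Polynomial ℝ) • F.toRows₁.map Polynomial.C -
    F.toRows₂.map Polynomial.C).det, fun h0 => ?_, fun κ => ?_⟩
  · have h1 := congrArg (Polynomial.aeval I) h0
    rw [map_zero, AlgHom.map_det] at h1
    have e : (Polynomial.aeval I : Polynomial ℝ →ₐ[ℝ] ℂ).mapMatrix
        ((Polynomial.X : Polynomial ℝ) • F.toRows₁.map Polynomial.C -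
          F.toRows₂.map Polynomial.C) = -(toC F.toRows₂ - I • toC F.toRows₁) := by
      ext i j
      simp [toC, mul_comm I]
    rw [e, det_neg] at h1
    rcases mul_eq_zero.mp h1 with h2 | h2
    · exact pow_ne_zero _ (by norm_num) h2
    · exact h.isUnit_sub.ne_zero h2
  · rw [← Polynomial.coe_evalRingHom, RingHom.map_det]
    congr 1
    ext i j
    simp [tilt, mul_comm κ]

theorem IsLagrangian.exists_tilt {F F' : Frame n} (h : IsLagrangian F) (h' : IsLagrangian F') :
    ∃ κ, IsUnit (tilt κ F).det ∧ IsUnit (tilt κ F').det := by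
  obtain ⟨p, hp, hpe⟩ := h.exists_polynomial
  obtain ⟨q, hq, hqe⟩ := h'.exists_polynomial
  obtain ⟨κ, hκ⟩ := Polynomial.exists_eval_ne_zero_of_natDegree_lt_card (p * q)
    (mul_ne_zero hp hq) (Cardinal.natCast_lt_aleph0.trans_le
      (Cardinal.aleph0_le_mk ℝ))
  rw [Polynomial.eval_mul, hpe, hqe] at hκ
  exact ⟨κ, (left_ne_zero_of_mul hκ).isUnit, (right_ne_zero_of_mul hκ).isUnit⟩

theorem IsLagrangian.slope_transpose {F : Frame n} (h : IsLagrangian F) {κ : ℝ}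
    (hκ : IsUnit (tilt κ F).det) : (slope κ F)ᵀ = slope κ F := by
  have e : F.toRows₁ᵀ * tilt κ F = (tilt κ F)ᵀ * F.toRows₁ := by
    rw [tilt, Matrix.mul_sub, transpose_sub, Matrix.sub_mul, h.comm, transpose_smul,
      Matrix.mul_smul, Matrix.smul_mul]
  have hκt : IsUnit (tilt κ F)ᵀ.det := by rwa [det_transpose]
  rw [slope, transpose_mul, transpose_nonsing_inv]
  have := congrArg (fun M => (tilt κ F)ᵀ⁻¹ * M * (tilt κ F)⁻¹) e
  rwa [Matrix.mul_assoc, mul_nonsing_inv_cancel_right _ _ hκ,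
    nonsing_inv_mul_cancel_left _ _ hκt] at this

theorem slope_mul_tilt {F : Frame n} {κ : ℝ} (hκ : IsUnit (tilt κ F).det) :
    slope κ F * tilt κ F = F.toRows₁ := by
  rw [slope, nonsing_inv_mul_cancel_right _ _ hκ]

theorem graphPair_slope {F Fh : Frame n} (h : IsLagrangian F) (h' : IsLagrangian Fh) {κ : ℝ}
    (hκ : IsUnit (tilt κ F).det) (hκ' : IsUnit (tilt κ Fh).det) :
    GraphPair F Fh (slope κ F) (slope κ Fh) (tilt κ F) (tilt κ Fh) where
  symmB := h.slope_transpose hκ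
  symmC := h'.slope_transpose hκ'
  unitG := hκ
  unitH := hκ'
  upper := (slope_mul_tilt hκ).symm
  upper' := (slope_mul_tilt hκ').symm
  wronskian_eq := by
    have e : (tilt κ F)ᵀ * slope κ F = F.toRows₁ᵀ := by
      rw [← h.slope_transpose hκ, ← transpose_mul, slope_mul_tilt hκ]
    rw [Matrix.mul_sub, Matrix.sub_mul, e, Matrix.mul_assoc, slope_mul_tilt hκ', tilt, tilt,
      transpose_sub, transpose_smul, Matrix.sub_mul, Matrix.mul_sub, Matrix.smul_mul,
      Matrix.mul_smul, wronskian_eq_sub]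
    abel

/-- With $T=\kappa X-U$ and $X=BT$ one has $U+cX=((\kappa+c)B-1)T$. Taking $c=\pm i$ exhibits the
phase as conjugate by $T$ to a function of $B$, so diagonalizing $B$ diagonalizes the phase. -/
theorem IsLagrangian.phase_eq {F : Frame n} (h : IsLagrangian F) {κ : ℝ}
    (hκ : IsUnit (tilt κ F).det) : ∃ (P Q : Matrix (Fin n) (Fin n) ℂ) (d : Fin n → ℝ),
      Q * P = 1 ∧ (slope κ F).charpoly.roots = Finset.univ.val.map d ∧
      phase F = P * diagonal (fun i => exp (I * branch κ (d i))) * Q := by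
  have hB : (slope κ F).IsHermitian := isHermitian_iff_transpose.mpr (h.slope_transpose hκ)
  obtain ⟨O, h1, h2, h3⟩ := real_spectral hB
  set d := hB.eigenvalues
  have hG := isUnit_det_toC hκ
  have h1' : toC Oᵀ * toC O = 1 := by rw [← toC_mul, h1, toC_one]
  have h2' : toC O * toC Oᵀ = 1 := by rw [← toC_mul, h2, toC_one]
  refine ⟨(toC (tilt κ F))⁻¹ * toC O, toC Oᵀ * toC (tilt κ F), d, ?_, ?_, ?_⟩
  · rw [Matrix.mul_assoc, mul_nonsing_inv_cancel_left _ _ hG, h1']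
  · conv_lhs => rw [h3]
    exact roots_charpoly_conj_diagonal h1 d
  · have hU : F.toRows₂ = κ • F.toRows₁ - tilt κ F := by rw [tilt]; abel
    have hX : toC F.toRows₁ = toC O * diagonal (fun i => (d i : ℂ)) * toC Oᵀ * toC (tilt κ F) := by
      rw [← toC_diagonal, ← toC_mul, ← toC_mul, ← toC_mul, ← h3, slope_mul_tilt hκ]
    have hT : toC (tilt κ F) = toC O * diagonal (fun _ => 1) * toC Oᵀ * toC (tilt κ F) := by
      simp [h2']
    have hlin : ∀ c : ℂ, toC F.toRows₂ + c • toC F.toRows₁ =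
        toC O * diagonal (fun i => (κ + c) * d i - 1) * toC Oᵀ * toC (tilt κ F) := by
      intro c
      have e : diagonal (fun i => (κ + c) * (d i : ℂ) - 1) =
          (κ + c) • diagonal (fun i => (d i : ℂ)) - diagonal (fun _ : Fin n => (1 : ℂ)) := by
        ext i j
        by_cases hij : i = j <;> simp [hij]
      rw [hU, toC_sub, toC_smul, e, Matrix.mul_sub, Matrix.sub_mul, Matrix.sub_mul, ← hT,
        Matrix.mul_smul, Matrix.smul_mul, Matrix.smul_mul, ← hX]
      module
    have key : (toC F.toRows₂ - I • toC F.toRows₁) * ((toC (tilt κ F))⁻¹ * toC O *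
        diagonal (fun i => exp (I * branch κ (d i))) * (toC Oᵀ * toC (tilt κ F))) =
        toC F.toRows₂ + I • toC F.toRows₁ := by
      have := hlin (-I)
      rw [neg_smul, ← sub_eq_add_neg] at this
      rw [this, hlin]
      calc _ = toC O * diagonal (fun i => (κ + -I) * d i - 1) * toC Oᵀ *
            (toC (tilt κ F) * ((toC (tilt κ F))⁻¹ * (toC O *
            diagonal (fun i => exp (I * branch κ (d i)))))) * toC Oᵀ * toC (tilt κ F) := by
            simp only [Matrix.mul_assoc]
        _ = toC O * (diagonal (fun i => (κ + -I) * d i - 1) * (toC Oᵀ * toC O) *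
            diagonal (fun i => exp (I * branch κ (d i)))) * toC Oᵀ * toC (tilt κ F) := by
            rw [mul_nonsing_inv_cancel_left _ _ hG]
            simp only [Matrix.mul_assoc]
        _ = _ := by
            rw [h1', Matrix.mul_one, diagonal_mul_diagonal]
            congr 4
            ext i
            rw [← mul_exp_branch]
            ring
    rw [phase, ← key, nonsing_inv_mul_cancel_left _ _ h.isUnit_sub]

theorem IsLagrangian.roots_phase {F : Frame n} (h : IsLagrangian F) {κ : ℝ}
    (hκ : IsUnit (tilt κ F).det) : (phase F).charpoly.roots =
      (slope κ F).charpoly.roots.map fun x => exp (I * branch κ x) := by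
  obtain ⟨P, Q, d, h1, h2, h3⟩ := h.phase_eq hκ
  rw [h3, roots_charpoly_conj_diagonal h1, h2, Multiset.map_map]
  rfl

theorem defect_sub_smul_one {M P Q : Matrix (Fin n) (Fin n) ℂ} {d : Fin n → ℂ} (h : Q * P = 1)
    (hM : M = P * diagonal d * Q) (z : ℂ) :
    defect (M - z • 1) = M.charpoly.roots.count z := by
  have hP : IsUnit P.det := (Matrix.isUnit_iff_isUnit_det _).1 (IsUnit.of_mul_eq_one_right _ h)
  have hQ : IsUnit Q.det := (Matrix.isUnit_iff_isUnit_det _).1 (IsUnit.of_mul_eq_one _ h)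
  have h' : P * Q = 1 := mul_eq_one_comm.mp h
  have e : M - z • 1 = P * diagonal (fun i => d i - z) * Q := by
    have : (diagonal fun i => d i - z) = diagonal d - z • (1 : Matrix (Fin n) (Fin n) ℂ) := by
      rw [smul_one_eq_diagonal, diagonal_sub]
    rw [this, Matrix.mul_sub, Matrix.sub_mul, ← hM]
    simp [h']
  have h1 := LinearMap.finrank_range_add_finrank_ker (Matrix.toLin' (M - z • 1))
  have h2 : Module.finrank ℂ (LinearMap.range (Matrix.toLin' (M - z • 1))) =
      Fintype.card {i // d i - z ≠ 0} := by
    rw [← Matrix.rank_diagonal, ← Matrix.rank_mul_eq_right_of_isUnit_det P _ hP,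
      ← Matrix.rank_mul_eq_left_of_isUnit_det Q _ hQ, ← e]
    rfl
  have h3 : M.charpoly.roots.count z = Fintype.card {i // d i - z = 0} := by
    rw [hM, roots_charpoly_conj_diagonal h, Multiset.count_map, Fintype.card_subtype,
      Finset.card_def, Finset.filter_val]
    congr 1
    exact Multiset.filter_congr fun i _ => by rw [sub_eq_zero, eq_comm]
  have h4 := Fintype.card_subtype_compl fun i => d i - z = 0
  have h5 := Fintype.card_subtype_le fun i => d i - z = 0
  rw [h2] at h1
  simp only [Module.finrank_fin_fun, Fintype.card_fin, ne_eq] at h1 h4 h5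
  rw [h3, defect]
  omega

end Frames

/-! ### Locally constant functions, matching of multisets, partitions -/

section General

theorem constant_of_eventually_eq {s : Set ℝ} (hs : IsPreconnected s) {f : ℝ → ℤ}
    (h : ∀ t ∈ s, ∀ᶠ u in 𝓝[s] t, f u = f t) {x y : ℝ} (hx : x ∈ s) (hy : y ∈ s) : f x = f y :=
  hs.constant (fun t ht => continuousWithinAt_const.congr_of_eventuallyEq (h t ht) rfl) hx hy

theorem constant_of_continuousOn_cast {s : Set ℝ} (hs : IsPreconnected s) {f : ℝ → ℤ}
    (h : ContinuousOn (fun t => (f t : ℝ)) s) {x y : ℝ} (hx : x ∈ s) (hy : y ∈ s) : f x = f y :=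
  hs.constant (Int.isClosedEmbedding_coe_real.isInducing.continuousOn_iff.2 h) hx hy

/-- A continuous real function without integer values on a connected set has constant floor. -/
theorem floor_eq_of_forall_ne {s : Set ℝ} (hs : IsPreconnected s) {f : ℝ → ℝ}
    (hf : ContinuousOn f s) (hne : ∀ t ∈ s, ∀ m : ℤ, f t ≠ m) {x y : ℝ} (hx : x ∈ s)
    (hy : y ∈ s) : ⌊f x⌋ = ⌊f y⌋ := by
  refine constant_of_eventually_eq hs (f := fun t => ⌊f t⌋) (fun t ht => ?_) hx hy
  have h1 : (⌊f t⌋ : ℝ) < f t := lt_of_le_of_ne (Int.floor_le _) (hne t ht _).symm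
  filter_upwards [(hf t ht).eventually (lt_mem_nhds h1),
    (hf t ht).eventually (gt_mem_nhds (Int.lt_floor_add_one (f t)))] with u hu1 hu2
  rw [Int.floor_eq_iff]
  exact ⟨hu1.le, hu2⟩

theorem exists_perm_of_map_univ_eq {ι β : Type*} [Fintype ι] {f g : ι → β}
    (h : Finset.univ.val.map f = Finset.univ.val.map g) : ∃ σ : Equiv.Perm ι, ∀ i, f i = g (σ i) := by
  classical
  have hc : ∀ y, Fintype.card {i // f i = y} = Fintype.card {i // g i = y} := fun y => by
    have := congrArg (Multiset.count y) h
    rw [Multiset.count_map, Multiset.count_map] at this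
    rw [Fintype.card_subtype, Fintype.card_subtype, Finset.card_def, Finset.card_def,
      Finset.filter_val, Finset.filter_val]
    simpa only [eq_comm] using this
  refine ⟨(Equiv.sigmaFiberEquiv f).symm.trans ((Equiv.sigmaCongrRight fun y =>
    Fintype.equivOfCardEq (hc y)).trans (Equiv.sigmaFiberEquiv g)), fun i => ?_⟩
  exact ((Fintype.equivOfCardEq (hc (f i))) ⟨i, rfl⟩).2.symm

/-- A partition subordinate to local data. -/
theorem exists_isPartition_of_local {α : Type*} {a b : ℝ} (hab : a < b) {Good : α → Set ℝ → Prop}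
    (hmono : ∀ c s s', s' ⊆ s → Good c s → Good c s')
    (hloc : ∀ t ∈ Set.Icc a b, ∃ c, ∃ δ > 0, Good c (Set.Icc a b ∩ Metric.ball t δ)) :
    ∃ (p : ℕ) (t : Fin (p + 1) → ℝ) (c : Fin p → α), IsPartition t a b ∧
      ∀ k : Fin p, Good (c k) (Set.Icc (t k.castSucc) (t k.succ)) := by
  have hloc' : ∀ t : Set.Icc a b, ∃ c, ∃ δ > 0, Good c (Set.Icc a b ∩ Metric.ball (t : ℝ) δ) :=
    fun t => hloc t t.2
  choose c δ hδ hg using hloc'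
  obtain ⟨ε, hε, hL⟩ := lebesgue_number_lemma_of_metric (s := Set.Icc a b)
    (c := fun x : Set.Icc a b => Metric.ball (x : ℝ) (δ x)) isCompact_Icc
    (fun _ => Metric.isOpen_ball)
    (fun x hx => Set.mem_iUnion.2 ⟨⟨x, hx⟩, Metric.mem_ball_self (hδ ⟨x, hx⟩)⟩)
  -- Enough equal steps to make the mesh smaller than the Lebesgue number, so each piece lies in the
  -- ball about its left node.
  obtain ⟨p, hp⟩ := exists_nat_gt ((b - a) / ε)
  have hba : 0 < b - a := sub_pos.2 hab
  have hp0 : (0 : ℝ) < p := (div_pos hba hε).trans hp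
  set h := (b - a) / p with hh
  have hpos : 0 < h := div_pos hba hp0
  have hlt : h < ε := by
    rw [hh, div_lt_iff₀ hp0]
    rw [div_lt_iff₀ hε] at hp
    linarith
  have hph : p * h = b - a := by rw [hh]; field_simp
  have hmem : ∀ k : Fin (p + 1), a + k * h ∈ Set.Icc a b := fun k => by
    have h1 : (k : ℝ) ≤ p := by exact_mod_cast Nat.lt_succ_iff.1 k.2
    have h2 : (k : ℝ) * h ≤ p * h := by gcongr
    have h3 : 0 ≤ (k : ℝ) * h := by positivity
    exact ⟨by linarith, by linarith⟩
  have hi : ∀ k : Fin p, ∃ x : Set.Icc a b,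
      Metric.ball (a + ((k.castSucc : Fin (p + 1)) : ℝ) * h) ε ⊆ Metric.ball (x : ℝ) (δ x) :=
    fun k => hL _ (hmem k.castSucc)
  choose x hx using hi
  refine ⟨p, fun k => a + k * h, fun k => c (x k), ⟨fun i j hij => ?_, by simp, ?_⟩, fun k => ?_⟩
  · have : (i : ℝ) < j := by exact_mod_cast hij
    gcongr
  · simp only [Fin.val_last]
    linarith
  · refine hmono _ _ _ ?_ (hg (x k))
    refine fun s hs => ⟨?_, hx k ?_⟩
    · exact ⟨(hmem k.castSucc).1.trans hs.1, hs.2.trans (hmem k.succ).2⟩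
    · have h1 := hs.1
      have h2 := hs.2
      simp only [Fin.val_castSucc, Fin.val_succ] at h1 h2
      push_cast at h2
      rw [Metric.mem_ball, Real.dist_eq, abs_lt, Fin.val_castSucc]
      constructor <;> linarith

theorem sum_telescope {p : ℕ} (f : Fin (p + 1) → ℤ) :
    ∑ k : Fin p, (f k.succ - f k.castSucc) = f (Fin.last p) - f 0 := by
  have h1 := Fin.sum_univ_succ f
  have h2 := Fin.sum_univ_castSucc f
  rw [Finset.sum_sub_distrib]
  linarith

theorem IsPartition.mem {p : ℕ} {t : Fin (p + 1) → ℝ} {a b : ℝ} (h : IsPartition t a b)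
    (k : Fin (p + 1)) : t k ∈ Set.Icc a b :=
  ⟨h.first ▸ h.strictMono.monotone (Fin.zero_le k), h.last ▸ h.strictMono.monotone (Fin.le_last k)⟩

theorem IsPartition.Icc_subset {p : ℕ} {t : Fin (p + 1) → ℝ} {a b : ℝ} (h : IsPartition t a b)
    (k : Fin p) : Set.Icc (t k.castSucc) (t k.succ) ⊆ Set.Icc a b :=
  Set.Icc_subset_Icc (h.mem _).1 (h.mem _).2

theorem IsPartition.le {p : ℕ} {t : Fin (p + 1) → ℝ} {a b : ℝ} (h : IsPartition t a b)
    (k : Fin p) : t k.castSucc ≤ t k.succ :=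
  (h.strictMono Fin.castSucc_lt_succ).le

end General

/-! ### Sums of integer parts along continuous angles -/

section AngleSums

open Complex

variable {n : ℕ}

/-- The number `φ / 2π` modulo `1`, as a function of `exp (i φ)`. -/
noncomputable def turnFract (z : ℂ) : ℝ := Int.fract (arg z / (2 * Real.pi))

theorem exp_I_mul_eq_iff {x y : ℝ} :
    exp (I * x) = exp (I * y) ↔ ∃ m : ℤ, x = y + 2 * Real.pi * m := by
  rw [Complex.exp_eq_exp_iff_exists_int]
  refine exists_congr fun m => ?_
  have e : I * (y : ℂ) + m * (2 * Real.pi * I) = I * ((y + 2 * Real.pi * m : ℝ) : ℂ) := by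
    push_cast; ring
  rw [e, mul_right_inj' I_ne_zero, ofReal_inj]

theorem turnFract_exp (x : ℝ) : turnFract (exp (I * x)) = Int.fract (x / (2 * Real.pi)) := by
  have h : exp (I * (arg (exp (I * x)) : ℝ)) = exp (I * x) := by
    have h1 : ‖exp (I * x)‖ = 1 := by rw [mul_comm]; exact norm_exp_ofReal_mul_I x
    have h2 := norm_mul_exp_arg_mul_I (exp (I * x))
    rw [h1, ofReal_one, one_mul, mul_comm] at h2
    exact h2
  obtain ⟨m, hm⟩ := exp_I_mul_eq_iff.1 h
  have hpi : 2 * Real.pi ≠ 0 := by positivity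
  rw [turnFract, hm, add_div, mul_div_cancel_left₀ _ hpi, Int.fract_add_intCast]

theorem windInt_eq (x : ℝ) : (windInt x : ℝ) = x / (2 * Real.pi) - turnFract (exp (I * x)) := by
  rw [turnFract_exp, windInt, Int.fract]; ring

/-- The fractional part of $\varphi/2\pi$ depends only on $e^{i\varphi}$, so the fractional parts
cancel in the sum. The right side is continuous along branches and the left side is an integer. -/
theorem sum_windInt_sub {φ ψ : Fin n → ℝ}
    (h : (Finset.univ.val.map fun j => exp (I * (φ j : ℂ))) =
      Finset.univ.val.map fun j => exp (I * (ψ j : ℂ))) :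
    ((∑ j, windInt (φ j) - ∑ j, windInt (ψ j) : ℤ) : ℝ) =
      (∑ j, φ j - ∑ j, ψ j) / (2 * Real.pi) := by
  have h1 := congrArg (fun s : Multiset ℂ => (s.map turnFract).sum) h
  simp only [Multiset.map_map, Function.comp_def] at h1
  change ∑ j, turnFract (exp (I * φ j)) = ∑ j, turnFract (exp (I * ψ j)) at h1
  push_cast
  simp only [windInt_eq, Finset.sum_sub_distrib, h1, ← Finset.sum_div]
  ring

/-- Continuous branches on `s` of the arguments of the eigenvalues of `M(t)`. -/
def IsBranch (M : ℝ → Matrix (Fin n) (Fin n) ℂ) (φ : Fin n → ℝ → ℝ) (s : Set ℝ) : Prop :=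
  (∀ j, ContinuousOn (φ j) s) ∧
    ∀ t ∈ s, (M t).charpoly.roots = Finset.univ.val.map fun j => exp (I * (φ j t : ℂ))

theorem IsBranch.mono {M : ℝ → Matrix (Fin n) (Fin n) ℂ} {φ : Fin n → ℝ → ℝ} {s s' : Set ℝ}
    (h : IsBranch M φ s) (hs : s' ⊆ s) : IsBranch M φ s' :=
  ⟨fun j => (h.1 j).mono hs, fun t ht => h.2 t (hs ht)⟩

/-- The sums of the integers of two families of branches differ by a constant. -/
theorem IsBranch.sum_windInt_sub_const {M : ℝ → Matrix (Fin n) (Fin n) ℂ} {φ ψ : Fin n → ℝ → ℝ}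
    {s : Set ℝ} (hs : IsPreconnected s) (hφ : IsBranch M φ s) (hψ : IsBranch M ψ s) {x y : ℝ}
    (hx : x ∈ s) (hy : y ∈ s) :
    ∑ j, windInt (φ j x) - ∑ j, windInt (ψ j x) = ∑ j, windInt (φ j y) - ∑ j, windInt (ψ j y) := by
  refine constant_of_continuousOn_cast hs
    (f := fun t => ∑ j, windInt (φ j t) - ∑ j, windInt (ψ j t)) ?_ hx hy
  have h1 : ContinuousOn (fun t => (∑ j, φ j t - ∑ j, ψ j t) / (2 * Real.pi)) s := by
    refine ContinuousOn.div_const (ContinuousOn.sub ?_ ?_) _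
    · exact continuousOn_finsetSum _ fun j _ => hφ.1 j
    · exact continuousOn_finsetSum _ fun j _ => hψ.1 j
  exact h1.congr fun t ht => sum_windInt_sub ((hφ.2 t ht).symm.trans (hψ.2 t ht))

/-- Gluing of branches at a common point. -/
theorem IsBranch.glue {M : ℝ → Matrix (Fin n) (Fin n) ℂ} {φ ψ : Fin n → ℝ → ℝ} {a c b : ℝ}
    (hac : a ≤ c) (hcb : c ≤ b) (hφ : IsBranch M φ (Set.Icc a c))
    (hψ : IsBranch M ψ (Set.Icc c b)) : ∃ χ, IsBranch M χ (Set.Icc a b) := by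
  have hc1 : c ∈ Set.Icc a c := ⟨hac, le_rfl⟩
  have hc2 : c ∈ Set.Icc c b := ⟨le_rfl, hcb⟩
  -- At $c$ both families list the same eigenvalues, so they match after a permutation and shifts by
  -- multiples of $2\pi$.
  obtain ⟨σ, hσ⟩ := exists_perm_of_map_univ_eq ((hφ.2 c hc1).symm.trans (hψ.2 c hc2))
  choose m hm using fun j => exp_I_mul_eq_iff.1 (hσ j)
  let χ : Fin n → ℝ → ℝ := fun j t =>
    if t ≤ c then φ j t else ψ (σ j) t + 2 * Real.pi * m j
  have e1 : ∀ j, Set.EqOn (χ j) (φ j) (Set.Icc a c) := fun j t ht => if_pos ht.2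
  have e2 : ∀ j, Set.EqOn (χ j) (fun t => ψ (σ j) t + 2 * Real.pi * m j) (Set.Icc c b) := by
    intro j t ht
    rcases ht.1.eq_or_lt with rfl | hlt
    · exact (if_pos le_rfl).trans (hm j)
    · exact if_neg (not_le.2 hlt)
  refine ⟨χ, fun j => ?_, fun t ht => ?_⟩
  · rw [← Set.Icc_union_Icc_eq_Icc hac hcb]
    exact ((hφ.1 j).congr (e1 j)).union_of_isClosed
      (((hψ.1 (σ j)).add continuousOn_const).congr (e2 j)) isClosed_Icc isClosed_Icc
  · rcases le_total t c with htc | htc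
    · rw [hφ.2 t ⟨ht.1, htc⟩]
      exact Multiset.map_congr rfl fun j _ => by rw [e1 j ⟨ht.1, htc⟩]
    · rw [hψ.2 t ⟨htc, ht.2⟩]
      have : ∀ j, exp (I * (χ j t : ℂ)) = exp (I * (ψ (σ j) t : ℂ)) := fun j =>
        exp_I_mul_eq_iff.2 ⟨m j, e2 j ⟨htc, ht.2⟩⟩
      simp only [this]
      have := Multiset.map_univ_val_equiv σ
      conv_lhs => rw [← this, Multiset.map_map]
      rfl

theorem exists_isBranch_of_local {M : ℝ → Matrix (Fin n) (Fin n) ℂ} {a b : ℝ} (hab : a < b)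
    (hloc : ∀ t ∈ Set.Icc a b, ∃ φ, ∃ δ > 0, IsBranch M φ (Set.Icc a b ∩ Metric.ball t δ)) :
    ∃ φ, IsBranch M φ (Set.Icc a b) := by
  obtain ⟨p, t, φ, ht, hφ⟩ := exists_isPartition_of_local hab
    (Good := fun φ s => IsBranch M φ s) (fun c s s' hs h => h.mono hs) hloc
  have hp : p ≠ 0 := by
    rintro rfl
    exact hab.ne (ht.first.symm.trans ht.last)
  have key : ∀ k : ℕ, ∀ hk : k < p, ∃ φ, IsBranch M φ (Set.Icc (t 0) (t (Fin.succ ⟨k, hk⟩))) := by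
    intro k
    induction k with
    | zero => exact fun hk => ⟨_, hφ ⟨0, hk⟩⟩
    | succ k ih =>
      intro hk
      obtain ⟨χ, hχ⟩ := ih (by omega)
      exact IsBranch.glue (ht.strictMono.monotone (Fin.zero_le _)) (ht.le ⟨k + 1, hk⟩) hχ
        (hφ ⟨k + 1, hk⟩)
  -- Stage $k$ of the induction reaches $t_{k+1}$, so stage $p-1$ reaches $b$.
  obtain ⟨χ, hχ⟩ := key (p - 1) (by omega)
  have e : Fin.succ ⟨p - 1, by omega⟩ = Fin.last p := by
    ext; simp; omega
  rw [e, ht.first, ht.last] at hχ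
  exact ⟨χ, hχ⟩

end AngleSums

/-! ### Angles along Lagrangian paths -/

section LagrangianPaths

open Complex

variable {n : ℕ}

theorem continuous_toRows₁ : Continuous fun F : Frame n => F.toRows₁ :=
  continuous_matrix fun _ _ => continuous_id.matrix_elem _ _

theorem continuous_tilt (κ : ℝ) : Continuous (tilt (n := n) κ) := by
  have h1 := continuous_toRows₁ (n := n)
  have h2 : Continuous fun F : Frame n => F.toRows₂ :=
    continuous_matrix fun _ _ => continuous_id.matrix_elem _ _
  unfold tilt
  fun_prop

theorem continuousAt_inv_of_isUnit {A : Matrix (Fin n) (Fin n) ℝ} (h : IsUnit A.det) :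
    ContinuousAt (fun A : Matrix (Fin n) (Fin n) ℝ => A⁻¹) A := by
  simp only [Matrix.inv_def, Ring.inverse_eq_inv']
  exact ((Continuous.matrix_det continuous_id).continuousAt.inv₀ h.ne_zero).smul
    (Continuous.matrix_adjugate continuous_id).continuousAt

theorem continuousAt_slope {κ : ℝ} {F : Frame n} (h : IsUnit (tilt κ F).det) :
    ContinuousAt (slope κ) F := by
  unfold slope
  exact ContinuousAt.mul continuous_toRows₁.continuousAt
    ((continuousAt_inv_of_isUnit h).comp (continuous_tilt κ).continuousAt)

theorem eventually_isUnit_tilt {κ : ℝ} {F : Frame n} (h : IsUnit (tilt κ F).det) :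
    ∀ᶠ F' in 𝓝 F, IsUnit (tilt κ F').det := by
  have hc : Continuous fun F' : Frame n => (tilt κ F').det := (continuous_tilt κ).matrix_det
  filter_upwards [hc.continuousAt.eventually_ne h.ne_zero] with F' hF' using hF'.isUnit

/-- Local branches of the angles, with explicit integers. -/
theorem IsLagrangianPath.exists_local_isBranch {F : ℝ → Frame n} {a b : ℝ}
    (hF : IsLagrangianPath F a b) {t₀ : ℝ} (ht₀ : t₀ ∈ Set.Icc a b) {κ : ℝ}
    (hκ : IsUnit (tilt κ (F t₀)).det) :
    ∃ δ > 0, ∃ ψ : Fin n → ℝ → ℝ,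
      IsBranch (fun t => phase (F t)) ψ (Set.Icc a b ∩ Metric.ball t₀ δ) ∧
      ∀ t ∈ Set.Icc a b ∩ Metric.ball t₀ δ, IsUnit (tilt κ (F t)).det ∧
        ∑ j, windInt (ψ j t) = -(posIdx (slope κ (F t)) : ℤ) := by
  have h1 := (hF.1 t₀ ht₀).eventually (eventually_isUnit_tilt hκ)
  rw [Metric.nhdsWithin_basis_ball.eventually_iff] at h1
  obtain ⟨δ, hδ, h1⟩ := h1
  rw [Set.inter_comm] at h1
  have hc : ContinuousOn (fun t => slope κ (F t)) (Set.Icc a b ∩ Metric.ball t₀ δ) := fun t ht =>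
    (continuousAt_slope (h1 ht)).comp_continuousWithinAt
      ((hF.1 t ht.1).mono Set.inter_subset_left)
  obtain ⟨β, hβ, hr⟩ := continuousOn_eigenvalues₀ hc fun t ht =>
    isHermitian_iff_transpose.2 ((hF.2 t ht.1).slope_transpose (h1 ht))
  have hr' : ∀ t ∈ Set.Icc a b ∩ Metric.ball t₀ δ, (slope κ (F t)).charpoly.roots =
      Finset.univ.val.map fun j : Fin n => β ((finCongr (Fintype.card_fin n).symm) j) t := by
    intro t ht
    rw [hr t ht, ← Multiset.map_univ_val_equiv (finCongr (Fintype.card_fin n).symm),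
      Multiset.map_map]
    rfl
  refine ⟨δ, hδ, fun j t => branch κ (β ((finCongr (Fintype.card_fin n).symm) j) t),
    ⟨fun j => (continuous_branch κ).comp_continuousOn (hβ _), fun t ht => ?_⟩,
    fun t ht => ⟨h1 ht, ?_⟩⟩
  · rw [(hF.2 t ht.1).roots_phase (h1 ht), hr' t ht, Multiset.map_map]
    rfl
  · simp only [windInt_branch]
    rw [posIdx, hr' t ht, Multiset.filter_map, Multiset.card_map, Finset.sum_ite,
      Finset.sum_const, Finset.sum_const_zero, add_zero, Finset.card_def, Finset.filter_val]
    simp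

theorem IsLagrangianPath.exists_isBranch {F : ℝ → Frame n} {a b : ℝ} (hab : a < b)
    (hF : IsLagrangianPath F a b) : ∃ φ, IsBranch (fun t => phase (F t)) φ (Set.Icc a b) :=
  exists_isBranch_of_local hab fun t ht => by
    obtain ⟨κ, hκ, -⟩ := (hF.2 t ht).exists_tilt (hF.2 t ht)
    obtain ⟨δ, hδ, ψ, hψ, -⟩ := hF.exists_local_isBranch ht hκ
    exact ⟨ψ, δ, hδ, hψ⟩

/-- For the local branch obtained from the eigenvalues of the slope the sum is $0$; any other branch
differs from it by a constant in the sum of integers. -/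
theorem IsLagrangianPath.eventually_sum_windInt {F : ℝ → Frame n} {a b : ℝ}
    (hF : IsLagrangianPath F a b) {φ : Fin n → ℝ → ℝ}
    (hφ : IsBranch (fun t => phase (F t)) φ (Set.Icc a b)) {t₀ : ℝ} (ht₀ : t₀ ∈ Set.Icc a b)
    {κ : ℝ} (hκ : IsUnit (tilt κ (F t₀)).det) :
    ∀ᶠ t in 𝓝[Set.Icc a b] t₀, ∑ j, windInt (φ j t) + posIdx (slope κ (F t)) =
      ∑ j, windInt (φ j t₀) + posIdx (slope κ (F t₀)) := by
  obtain ⟨δ, hδ, ψ, hψ, hw⟩ := hF.exists_local_isBranch ht₀ hκ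
  have hs : IsPreconnected (Set.Icc a b ∩ Metric.ball t₀ δ) :=
    ((convex_Icc a b).inter (convex_ball t₀ δ)).isPreconnected
  have hm : t₀ ∈ Set.Icc a b ∩ Metric.ball t₀ δ := ⟨ht₀, Metric.mem_ball_self hδ⟩
  filter_upwards [inter_mem_nhdsWithin (Set.Icc a b) (Metric.ball_mem_nhds t₀ hδ)] with t ht
  have h1 := (hφ.mono Set.inter_subset_left).sum_windInt_sub_const hs hψ ht hm
  have h2 := (hw t ht).2
  have h3 := (hw t₀ hm).2
  linarith

end LagrangianPaths

/-! ### Symplectic matrices acting on frames -/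

section Symplectic

variable {n : ℕ}

theorem calJ_eq_neg_J : calJ n = -Matrix.J (Fin n) ℝ := by
  rw [calJ, Matrix.J, fromBlocks_neg]; simp

theorem isSymplectic_iff {S : BMat n} : IsSymplectic S ↔ Sᵀ * calJ n * S = calJ n := by
  rw [IsSymplectic, SymplecticGroup.mem_iff', calJ_eq_neg_J]
  simp

theorem IsSymplectic.isUnit_det {S : BMat n} (h : IsSymplectic S) : IsUnit S.det :=
  SymplecticGroup.symplectic_det h

theorem IsSymplectic.inv_eq {S : BMat n} (h : IsSymplectic S) :
    S⁻¹ = -Matrix.J (Fin n) ℝ * Sᵀ * Matrix.J (Fin n) ℝ :=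
  SymplecticGroup.inv_eq_symplectic_inv S h

theorem IsSymplectic.inv {S : BMat n} (h : IsSymplectic S) : IsSymplectic S⁻¹ := by
  have := ((⟨S, h⟩ : symplecticGroup (Fin n) ℝ)⁻¹).2
  rwa [SymplecticGroup.coe_inv'] at this

theorem IsSymplectic.mul {S T : BMat n} (h : IsSymplectic S) (h' : IsSymplectic T) :
    IsSymplectic (S * T) := (symplecticGroup (Fin n) ℝ).mul_mem h h'

theorem IsSymplectic.wronskian_mul {S : BMat n} (h : IsSymplectic S) (F Fh : Frame n) :
    wronskian (S * F) (S * Fh) = wronskian F Fh := by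
  rw [wronskian, transpose_mul]
  calc Fᵀ * Sᵀ * calJ n * (S * Fh) = Fᵀ * (Sᵀ * calJ n * S) * Fh := by
        simp only [Matrix.mul_assoc]
    _ = _ := by rw [isSymplectic_iff.1 h, wronskian]

theorem IsSymplectic.isLagrangian_mul {S : BMat n} (h : IsSymplectic S) {F : Frame n}
    (hF : IsLagrangian F) : IsLagrangian (S * F) :=
  ⟨(h.wronskian_mul F F).trans hF.1, by
    rw [rank_mul_eq_right_of_isUnit_det _ _ h.isUnit_det, hF.2]⟩

theorem isLagrangian_vertE : IsLagrangian (vertE n) := by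
  refine ⟨?_, ?_⟩
  · change wronskian (vertE n) (vertE n) = 0
    rw [wronskian_eq_sub]
    simp [vertE]
  · rw [← rank_transpose_mul_self, gram_eq]
    simp [vertE]

theorem ContinuousOn.inv_of_isSymplectic {Z : ℝ → BMat n} {s : Set ℝ} (hZ : ContinuousOn Z s)
    (h : ∀ t ∈ s, IsSymplectic (Z t)) : ContinuousOn (fun t => (Z t)⁻¹) s := by
  refine ContinuousOn.congr (f := fun t => -Matrix.J (Fin n) ℝ * (Z t)ᵀ * Matrix.J (Fin n) ℝ) ?_
    fun t ht => (h t ht).inv_eq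
  have : Continuous fun A : BMat n => -Matrix.J (Fin n) ℝ * Aᵀ * Matrix.J (Fin n) ℝ := by fun_prop
  exact this.comp_continuousOn hZ

theorem IsLagrangianPath.symplectic_mul {F : ℝ → Frame n} {L : ℝ → BMat n} {a b : ℝ}
    (hF : IsLagrangianPath F a b) (hL : ContinuousOn L (Set.Icc a b))
    (h : ∀ t ∈ Set.Icc a b, IsSymplectic (L t)) : IsLagrangianPath (fun t => L t * F t) a b := by
  refine ⟨?_, fun t ht => (h t ht).isLagrangian_mul (hF.2 t ht)⟩
  have : Continuous fun p : BMat n × Frame n => p.1 * p.2 := by fun_prop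
  exact this.comp_continuousOn (hL.prodMk hF.1)

theorem rank_neg_matrix (A : Matrix (Fin n) (Fin n) ℝ) : (-A).rank = A.rank := by
  rw [← rank_mul_eq_right_of_isUnit_det (-1) A (by rw [det_neg]; simp)]
  simp

theorem rank_wronskian_comm (F Fh : Frame n) : (wronskian F Fh).rank = (wronskian Fh F).rank := by
  have : wronskian F Fh = -(wronskian Fh F)ᵀ := by
    rw [wronskian_eq_sub, wronskian_eq_sub]; simp
  rw [this, rank_neg_matrix, rank_transpose]

theorem toRows₁_mul_of_lower {L : BMat n} (h : L.toBlocks₁₂ = 0) (F : Frame n) :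
    (L * F).toRows₁ = L.toBlocks₁₁ * F.toRows₁ := by
  conv_lhs => rw [← fromBlocks_toBlocks L, ← fromRows_toRows F, fromBlocks_mul_fromRows, h]
  simp

end Symplectic

/-! ### Oscillation numbers -/

section Oscillation

variable {n : ℕ}

theorem IsLagrangianPath.mono {F : ℝ → Frame n} {a b c d : ℝ} (h : IsLagrangianPath F a b)
    (hs : Set.Icc c d ⊆ Set.Icc a b) : IsLagrangianPath F c d :=
  ⟨h.1.mono hs, fun t ht => h.2 t (hs ht)⟩

/-- On an interval where the relevant ranks are constant the change of the comparative index is the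
change of the integers of the angles. -/
theorem compIndex_sub_sum_windInt_const {F V : ℝ → Frame n} {c d : ℝ}
    (hF : IsLagrangianPath F c d) (hV : IsLagrangianPath V c d) {φ : Fin n → ℝ → ℝ}
    (hφ : IsBranch (fun t => phase (F t)) φ (Set.Icc c d)) {r r' : ℕ}
    (hr : ∀ t ∈ Set.Icc c d, (wronskian (V t) (F t)).rank = r)
    (hr' : ∀ t ∈ Set.Icc c d, (V t).toRows₁.rank = r') {x y : ℝ} (hx : x ∈ Set.Icc c d)
    (hy : y ∈ Set.Icc c d) :
    (compIndex (F x) (V x) : ℤ) - ∑ j, windInt (φ j x) =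
      compIndex (F y) (V y) - ∑ j, windInt (φ j y) := by
  refine constant_of_eventually_eq isPreconnected_Icc
    (f := fun t => (compIndex (F t) (V t) : ℤ) - ∑ j, windInt (φ j t)) (fun t₀ ht₀ => ?_) hx hy
  -- A single $\kappa$ for both frames puts them in common graph coordinates; the two rank
  -- conditions become constancy of the ranks of $C$ and $B-C$.
  obtain ⟨κ, hκ, hκ'⟩ := (hF.2 t₀ ht₀).exists_tilt (hV.2 t₀ ht₀)
  have hm := self_mem_nhdsWithin (a := t₀) (s := Set.Icc c d)
  have h1 := (hF.1 t₀ ht₀).eventually (eventually_isUnit_tilt hκ)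
  have h2 := (hV.1 t₀ ht₀).eventually (eventually_isUnit_tilt hκ')
  have hB : Tendsto (fun t => slope κ (F t)) (𝓝[Set.Icc c d] t₀) (𝓝 (slope κ (F t₀))) :=
    (continuousAt_slope hκ).tendsto.comp (hF.1 t₀ ht₀)
  have hC : Tendsto (fun t => slope κ (V t)) (𝓝[Set.Icc c d] t₀) (𝓝 (slope κ (V t₀))) :=
    (continuousAt_slope hκ').tendsto.comp (hV.1 t₀ ht₀)
  have hherm : ∀ {F : Frame n}, IsLagrangian F → IsUnit (tilt κ F).det →
      (slope κ F).IsHermitian := fun h h' => isHermitian_iff_transpose.2 (h.slope_transpose h')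
  have rankC : ∀ t ∈ Set.Icc c d, IsUnit (tilt κ (V t)).det → (slope κ (V t)).rank = r' := by
    intro t ht hu
    rw [← hr' t ht, ← slope_mul_tilt hu, rank_mul_eq_left_of_isUnit_det _ _ hu]
  have rankBC : ∀ t ∈ Set.Icc c d, IsUnit (tilt κ (F t)).det → IsUnit (tilt κ (V t)).det →
      (slope κ (F t) - slope κ (V t)).rank = r := by
    intro t ht hu hu'
    rw [← hr t ht, rank_wronskian_comm,
      (graphPair_slope (hF.2 t ht) (hV.2 t ht) hu hu').wronskian_eq,
      rank_mul_eq_left_of_isUnit_det _ _ hu', rank_mul_eq_right_of_isUnit_det _ _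
        (by rwa [det_transpose]), ← rank_neg_matrix, neg_sub]
  have h3 := eventually_posIdx_eq_of_rank (hherm (hV.2 t₀ ht₀) hκ')
    (by filter_upwards [hm, h2] with t ht hu using hherm (hV.2 t ht) hu) hC
    (by filter_upwards [hm, h2] with t ht hu using
      (rankC t ht hu).trans (rankC t₀ ht₀ hκ').symm)
  have h4 := eventually_posIdx_eq_of_rank
    ((hherm (hF.2 t₀ ht₀) hκ).sub (hherm (hV.2 t₀ ht₀) hκ'))
    (by filter_upwards [hm, h1, h2] with t ht hu hu' using
      (hherm (hF.2 t ht) hu).sub (hherm (hV.2 t ht) hu')) (hB.sub hC)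
    (by filter_upwards [hm, h1, h2] with t ht hu hu' using
      (rankBC t ht hu hu').trans (rankBC t₀ ht₀ hκ hκ').symm)
  have h5 := hF.eventually_sum_windInt hφ ht₀ hκ
  have h6 := (graphPair_slope (hF.2 t₀ ht₀) (hV.2 t₀ ht₀) hκ hκ').compIndex_add_posIdx
  filter_upwards [hm, h1, h2, h3, h4, h5] with t ht hu hu' h3 h4 h5
  have h7 := (graphPair_slope (hF.2 t ht) (hV.2 t ht) hu hu').compIndex_add_posIdx
  rw [h3, h4] at h7
  have h8 : (compIndex (F t) (V t) : ℤ) + posIdx (slope κ (F t)) =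
      compIndex (F t₀) (V t₀) + posIdx (slope κ (F t₀)) := by exact_mod_cast h7.trans h6.symm
  linarith

theorem oscSum_eq {F : ℝ → Frame n} {a b : ℝ} (hF : IsLagrangianPath F a b) {φ : Fin n → ℝ → ℝ}
    (hφ : IsBranch (fun t => phase (F t)) φ (Set.Icc a b)) {p : ℕ} {t : Fin (p + 1) → ℝ}
    {R : Fin p → ℝ → BMat n} (ht : IsPartition t a b) (hR : IsOscSystem F t R) :
    oscSum F t R = ∑ j, windInt (φ j b) - ∑ j, windInt (φ j a) := by
  have key : ∀ k : Fin p, (compIndex (F (t k.succ)) (R k (t k.succ) * vertE n) : ℤ) -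
      compIndex (F (t k.castSucc)) (R k (t k.castSucc) * vertE n) =
      ∑ j, windInt (φ j (t k.succ)) - ∑ j, windInt (φ j (t k.castSucc)) := by
    intro k
    obtain ⟨hc, hs, ⟨r, hr⟩, ⟨r', hr'⟩⟩ := hR k
    have hE : IsLagrangianPath (fun _ => vertE n) (t k.castSucc) (t k.succ) :=
      ⟨continuousOn_const, fun _ _ => isLagrangian_vertE⟩
    have := compIndex_sub_sum_windInt_const (hF.mono (ht.Icc_subset k)) (hE.symplectic_mul hc hs)
      (hφ.mono (ht.Icc_subset k)) hr hr' (Set.right_mem_Icc.2 (ht.le k))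
      (Set.left_mem_Icc.2 (ht.le k))
    linarith
  rw [oscSum, Finset.sum_congr rfl fun k _ => key k,
    sum_telescope fun k => ∑ j, windInt (φ j (t k)), ht.first, ht.last]

theorem oscValues_nonempty {F : ℝ → Frame n} {a b : ℝ} (hab : a < b)
    (hF : IsLagrangianPath F a b) : (oscValues F a b).Nonempty := by
  obtain ⟨p, t, κ, ht, hκ⟩ := exists_isPartition_of_local hab
    (Good := fun (κ : ℝ) s => ∀ t ∈ s, IsUnit (tilt κ (F t)).det)
    (fun c s s' hs h t ht => h t (hs ht)) fun t₀ ht₀ => by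
      obtain ⟨κ, hκ, -⟩ := (hF.2 t₀ ht₀).exists_tilt (hF.2 t₀ ht₀)
      have h1 := (hF.1 t₀ ht₀).eventually (eventually_isUnit_tilt hκ)
      rw [Metric.nhdsWithin_basis_ball.eventually_iff] at h1
      obtain ⟨δ, hδ, h1⟩ := h1
      rw [Set.inter_comm] at h1
      exact ⟨κ, δ, hδ, fun t ht => h1 ht⟩
  -- A constant $R_k$ sending the vertical plane to the graph of $\kappa_k$ is admissible: the upper
  -- block is $I$ and the Wronskian is $-(\kappa_kX-U)$, both of rank $n$.
  have hE : ∀ κ : ℝ, (fromBlocks 0 1 (-1) (κ • 1) : BMat n) * vertE n = fromRows 1 (κ • 1) := by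
    intro κ
    rw [vertE, fromBlocks_mul_fromRows]; simp
  refine ⟨_, p, t, fun k _ => fromBlocks 0 1 (-1) (κ k • 1), ht, fun k => ⟨continuousOn_const,
    fun s hs => ?_, ⟨n, fun s hs => ?_⟩, ⟨n, fun s hs => ?_⟩⟩, rfl⟩
  · rw [isSymplectic_iff, calJ, fromBlocks_transpose, fromBlocks_multiply, fromBlocks_multiply]
    simp
  · have e : wronskian ((fromBlocks 0 1 (-1) (κ k • 1) : BMat n) * vertE n) (F s) =
        -tilt (κ k) (F s) := by
      rw [hE, wronskian_eq_sub, tilt]; simp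
    rw [e, rank_neg_matrix, rank_of_isUnit _ ((Matrix.isUnit_iff_isUnit_det _).2 (hκ k s hs))]
    simp
  · rw [hE]; simp

theorem oscValues_eq {F : ℝ → Frame n} {a b : ℝ} (hab : a < b) (hF : IsLagrangianPath F a b)
    {φ : Fin n → ℝ → ℝ} (hφ : IsBranch (fun t => phase (F t)) φ (Set.Icc a b)) :
    oscValues F a b = {∑ j, windInt (φ j b) - ∑ j, windInt (φ j a)} := by
  refine Set.eq_singleton_iff_nonempty_unique_mem.2 ⟨oscValues_nonempty hab hF, ?_⟩
  rintro _ ⟨p, t, R, ht, hR, rfl⟩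
  exact oscSum_eq hF hφ ht hR

/-- Lower block triangular symplectic transformations do not change the oscillation sums. -/
theorem oscValues_subset_of_lower {F F' : ℝ → Frame n} {L : ℝ → BMat n} {a b : ℝ}
    (hF : IsLagrangianPath F a b) (hL : ContinuousOn L (Set.Icc a b))
    (hs : ∀ t ∈ Set.Icc a b, IsSymplectic (L t)) (hl : ∀ t ∈ Set.Icc a b, (L t).toBlocks₁₂ = 0)
    (hF' : ∀ t ∈ Set.Icc a b, F' t = L t * F t) : oscValues F a b ⊆ oscValues F' a b := by
  rintro _ ⟨p, t, R, ht, hR, rfl⟩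
  have hunit : ∀ s ∈ Set.Icc a b, IsUnit (L s).toBlocks₁₁.det := fun s hs' => by
    have := (hs s hs').isUnit_det
    rw [← fromBlocks_toBlocks (L s), hl s hs', det_fromBlocks_zero₁₂] at this
    exact isUnit_of_mul_isUnit_left this
  -- Transporting $R_k$ by the same $L$ preserves Wronskians and multiplies upper blocks by the
  -- invertible $L_{11}$.
  refine ⟨p, t, fun k s => L s * R k s, ht, fun k => ?_, ?_⟩
  · obtain ⟨hc, hsy, ⟨r, hr⟩, ⟨r', hr'⟩⟩ := hR k
    have hsub := ht.Icc_subset k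
    refine ⟨?_, fun s hs' => (hs s (hsub hs')).mul (hsy s hs'), ⟨r, fun s hs' => ?_⟩,
      ⟨r', fun s hs' => ?_⟩⟩
    · exact (hL.mono hsub).mul hc
    · rw [hF' s (hsub hs'), Matrix.mul_assoc, (hs s (hsub hs')).wronskian_mul, hr s hs']
    · rw [Matrix.mul_assoc, toRows₁_mul_of_lower (hl s (hsub hs')),
        rank_mul_eq_right_of_isUnit_det _ _ (hunit s (hsub hs')), hr' s hs']
  · have key : ∀ k : Fin p, ∀ s ∈ Set.Icc (t k.castSucc) (t k.succ),
        compIndex (F' s) (L s * R k s * vertE n) = compIndex (F s) (R k s * vertE n) := by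
      intro k s hsk
      have hs' := ht.Icc_subset k hsk
      have hRE := ((hR k).2.1 s hsk).isLagrangian_mul isLagrangian_vertE
      obtain ⟨κ, hκ, hκ'⟩ := (hF.2 s hs').exists_tilt hRE
      rw [Matrix.mul_assoc, hF' s hs']
      exact compIndex_congr (hunit s hs') (toRows₁_mul_of_lower (hl s hs') _)
        (toRows₁_mul_of_lower (hl s hs') _) ((hs s hs').wronskian_mul _ _)
        (graphPair_slope (hF.2 s hs') hRE hκ hκ').pinv_mul_compV
    refine Finset.sum_congr rfl fun k _ => ?_
    rw [key k _ (Set.right_mem_Icc.2 (ht.le k)), key k _ (Set.left_mem_Icc.2 (ht.le k))]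

end Oscillation

/-! ### The orthogonal symplectic matrix of a Lagrangian frame -/

section Normalization

variable {n : ℕ}

theorem IsLagrangian.spectrum_gram_pos {Y : Frame n} (h : IsLagrangian Y) :
    ∀ x ∈ spectrum ℝ (Yᵀ * Y), 0 < x := by
  have hs : (Yᵀ * Y).PosSemidef := by
    have := posSemidef_conjTranspose_mul_self Y
    rwa [conjTranspose_eq_transpose_of_trivial] at this
  have hp : (Yᵀ * Y).PosDef :=
    hs.posDef_iff_isUnit.2 ((Matrix.isUnit_iff_isUnit_det _).2 h.isUnit_gram)
  intro x hx
  rw [hp.1.spectrum_real_eq_range_eigenvalues] at hx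
  obtain ⟨i, rfl⟩ := hx
  exact hp.eigenvalues_pos i

theorem matK_transpose (Y : Frame n) : (matK Y)ᵀ = matK Y := by
  have h : IsSelfAdjoint (matK Y) := cfc_predicate _ _
  rwa [IsSelfAdjoint, Matrix.star_eq_conjTranspose, conjTranspose_eq_transpose_of_trivial] at h

theorem IsLagrangian.matK_mul_gram_mul {Y : Frame n} (h : IsLagrangian Y) :
    matK Y * (Yᵀ * Y) * matK Y = 1 := by
  have hsa : IsSelfAdjoint (Yᵀ * Y) := by
    rw [IsSelfAdjoint, Matrix.star_eq_conjTranspose, conjTranspose_eq_transpose_of_trivial]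
    simp
  have hc : ∀ f : ℝ → ℝ, ContinuousOn f (spectrum ℝ (Yᵀ * Y)) :=
    fun f => (Matrix.finite_real_spectrum).continuousOn f
  have hid : cfc (fun x : ℝ => x) (Yᵀ * Y) = Yᵀ * Y := cfc_id' ℝ _
  have h1 := cfc_mul (fun x : ℝ => x ^ (-(1 / 2) : ℝ)) (fun x : ℝ => x) (Yᵀ * Y) (hc _) (hc _)
  have h2 := cfc_mul (fun x : ℝ => x ^ (-(1 / 2) : ℝ) * x) (fun x : ℝ => x ^ (-(1 / 2) : ℝ))
    (Yᵀ * Y) (hc _) (hc _)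
  rw [h1, hid] at h2
  rw [matK, ← h2, ← cfc_one ℝ (Yᵀ * Y)]
  refine cfc_congr fun x hx => ?_
  have hx0 := h.spectrum_gram_pos x hx
  have e : x ^ (-(1 / 2) : ℝ) * x * x ^ (-(1 / 2) : ℝ) =
      x ^ (-(1 / 2) : ℝ) * x ^ (-(1 / 2) : ℝ) * x := by ring
  simp only [Pi.one_apply]
  rw [e, ← Real.rpow_add hx0]
  norm_num [Real.rpow_neg_one]
  field_simp

theorem IsLagrangian.isUnit_matK {Y : Frame n} (h : IsLagrangian Y) : IsUnit (matK Y).det := by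
  have := congrArg Matrix.det h.matK_mul_gram_mul
  rw [det_mul, det_one] at this
  exact IsUnit.of_mul_eq_one_right _ this

open scoped Matrix.Norms.L2Operator in
theorem continuousOn_matK {Y : ℝ → Frame n} {s : Set ℝ} (hY : ContinuousOn Y s)
    (h : ∀ t ∈ s, IsLagrangian (Y t)) : ContinuousOn (fun t => matK (Y t)) s := by
  have hg : ContinuousOn (fun t => (Y t)ᵀ * Y t) s := by
    have : Continuous fun F : Frame n => Fᵀ * F := by fun_prop
    exact this.comp_continuousOn hY
  refine ContinuousOn.cfc_of_mem_nhdsSet (s := Set.Ioi 0) (fun x : ℝ => x ^ (-(1 / 2) : ℝ)) ?_ hg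
    (fun t _ => ?_) ?_
  · refine isOpen_Ioi.mem_nhdsSet.2 (Set.iUnion₂_subset fun t ht x hx => ?_)
    exact (h t ht).spectrum_gram_pos x hx
  · rw [IsSelfAdjoint, Matrix.star_eq_conjTranspose, conjTranspose_eq_transpose_of_trivial]
    simp
  · exact fun x hx => (Real.continuousAt_rpow_const x _ (Or.inl (ne_of_gt hx))).continuousWithinAt

theorem calJ_transpose : (calJ n)ᵀ = -calJ n := by
  rw [calJ_eq_neg_J]; simp

theorem calJ_mul_calJ : calJ n * calJ n = -1 := by
  rw [calJ_eq_neg_J]; simp [J_squared]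

theorem IsLagrangian.matZ_transpose_mul {Y : Frame n} (h : IsLagrangian Y) :
    (matZ Y)ᵀ * matZ Y = 1 := by
  have hL : Yᵀ * calJ n * Y = 0 := h.1
  have hK : matK Y * Yᵀ * Y * matK Y = 1 := by
    rw [Matrix.mul_assoc (matK Y), h.matK_mul_gram_mul]
  have hJ : ∀ M : Matrix (Fin n ⊕ Fin n) (Fin n) ℝ, calJ n * (calJ n * M) = -M := fun M => by
    rw [← Matrix.mul_assoc, calJ_mul_calJ]; simp
  rw [matZ, transpose_fromCols, fromRows_mul_fromCols, ← fromBlocks_one]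
  simp only [transpose_mul, matK_transpose, calJ_transpose, Matrix.mul_neg, Matrix.neg_mul]
  congr 1
  · rw [← hK]
    simp only [Matrix.mul_assoc, hJ, Matrix.mul_neg, neg_neg]
  · have : matK Y * (Yᵀ * calJ n) * (Y * matK Y) = matK Y * (Yᵀ * calJ n * Y) * matK Y := by
      simp only [Matrix.mul_assoc]
    rw [this, hL]; simp
  · have : matK Y * Yᵀ * (calJ n * Y * matK Y) = matK Y * (Yᵀ * calJ n * Y) * matK Y := by
      simp only [Matrix.mul_assoc]
    rw [this, hL]; simp
  · rw [← hK]
    simp only [Matrix.mul_assoc]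

theorem IsLagrangian.isSymplectic_matZ {Y : Frame n} (h : IsLagrangian Y) :
    IsSymplectic (matZ Y) := by
  have hL : Yᵀ * calJ n * Y = 0 := h.1
  have hK : matK Y * Yᵀ * Y * matK Y = 1 := by
    rw [Matrix.mul_assoc (matK Y), h.matK_mul_gram_mul]
  have hJ : ∀ M : Matrix (Fin n ⊕ Fin n) (Fin n) ℝ, calJ n * (calJ n * M) = -M := fun M => by
    rw [← Matrix.mul_assoc, calJ_mul_calJ]; simp
  have h0 : matK Y * (Yᵀ * (calJ n * (Y * matK Y))) = 0 := by
    have : matK Y * (Yᵀ * (calJ n * (Y * matK Y))) = matK Y * (Yᵀ * calJ n * Y) * matK Y := by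
      simp only [Matrix.mul_assoc]
    rw [this, hL]; simp
  have h1 : matK Y * (Yᵀ * (Y * matK Y)) = 1 := by
    rw [← hK]; simp only [Matrix.mul_assoc]
  rw [isSymplectic_iff, matZ, transpose_fromCols, fromRows_mul, fromRows_mul_fromCols]
  conv_rhs => rw [calJ]
  simp only [transpose_mul, matK_transpose, calJ_transpose, Matrix.mul_neg, Matrix.neg_mul,
    Matrix.mul_assoc, hJ, neg_neg, h0, h1, neg_zero]

theorem IsLagrangian.matZ_inv {Y : Frame n} (h : IsLagrangian Y) : (matZ Y)⁻¹ = (matZ Y)ᵀ :=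
  inv_eq_left_inv h.matZ_transpose_mul

theorem matZ_transpose_mul_frame (Y Yh : Frame n) : (matZ Y)ᵀ * Yh =
    fromRows (-(matK Y * wronskian Y Yh)) (matK Y * (Yᵀ * Yh)) := by
  rw [matZ, transpose_fromCols, fromRows_mul]
  simp only [transpose_mul, matK_transpose, calJ_transpose, Matrix.mul_neg, Matrix.neg_mul,
    wronskian, Matrix.mul_assoc]

theorem continuousOn_matZ {Y : ℝ → Frame n} {a b : ℝ} (hY : IsLagrangianPath Y a b) :
    ContinuousOn (fun t => matZ (Y t)) (Set.Icc a b) := by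
  have hK := continuousOn_matK hY.1 hY.2
  have hmul : Continuous fun p : Frame n × Matrix (Fin n) (Fin n) ℝ => p.1 * p.2 := by fun_prop
  have h1 : ContinuousOn (fun t => Y t * matK (Y t)) (Set.Icc a b) :=
    hmul.comp_continuousOn (hY.1.prodMk hK)
  have h2 : ContinuousOn (fun t => calJ n * Y t * matK (Y t)) (Set.Icc a b) := by
    have : Continuous fun F : Frame n => calJ n * F := by fun_prop
    exact hmul.comp_continuousOn ((this.comp_continuousOn hY.1).prodMk hK)
  have h3 : Continuous fun p : Frame n × Frame n => fromCols p.1 p.2 := by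
    refine continuous_matrix fun i j => ?_
    rcases j with j | j
    · exact continuous_fst.matrix_elem i j
    · exact continuous_snd.matrix_elem i j
  exact h3.comp_continuousOn (h2.prodMk h1)

theorem IsLagrangianPath.matZ_inv_mul {Y Yh : ℝ → Frame n} {a b : ℝ}
    (hY : IsLagrangianPath Y a b) (hYh : IsLagrangianPath Yh a b) :
    IsLagrangianPath (fun t => (matZ (Y t))⁻¹ * Yh t) a b :=
  hYh.symplectic_mul (ContinuousOn.inv_of_isSymplectic (continuousOn_matZ hY)
    fun t ht => (hY.2 t ht).isSymplectic_matZ) fun t ht => (hY.2 t ht).isSymplectic_matZ.inv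

end Normalization

/-! ### The phase behind $\Gamma$ and the Lidskii angles -/

section Phase

open Complex

variable {n : ℕ}

theorem cPlus_eq (F : Frame n) : cPlus F = toC F.toRows₁ + I • toC F.toRows₂ := rfl

theorem cMinus_eq (F : Frame n) : cMinus F = toC F.toRows₁ - I • toC F.toRows₂ := rfl

theorem IsLagrangian.isUnit_cPlus {F : Frame n} (h : IsLagrangian F) : IsUnit (cPlus F).det := by
  have : cPlus F = I • (toC F.toRows₂ - I • toC F.toRows₁) := by
    rw [smul_sub, smul_smul, I_mul_I, cPlus_eq]; module
  rw [this, det_smul]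
  exact ((IsUnit.mk0 _ I_ne_zero).pow _).mul h.isUnit_sub

theorem IsLagrangian.isUnit_cMinus {F : Frame n} (h : IsLagrangian F) : IsUnit (cMinus F).det := by
  have : cMinus F = (-I) • (toC F.toRows₂ + I • toC F.toRows₁) := by
    rw [smul_add, smul_smul, neg_mul, I_mul_I, cMinus_eq]; module
  rw [this, det_smul]
  exact ((IsUnit.mk0 _ (neg_ne_zero.2 I_ne_zero)).pow _).mul h.isUnit_add

theorem rows_matZ_add (Y Yh : Frame n) :
    toC ((matZ Y)ᵀ * Yh).toRows₂ + I • toC ((matZ Y)ᵀ * Yh).toRows₁ =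
      toC (matK Y) * ((cPlus Y)ᵀ * cMinus Yh) := by
  have e : Yᵀ * Yh = Y.toRows₁ᵀ * Yh.toRows₁ + Y.toRows₂ᵀ * Yh.toRows₂ := by
    conv_lhs => rw [← fromRows_toRows Y, ← fromRows_toRows Yh]
    rw [transpose_fromRows, fromCols_mul_fromRows]
  rw [matZ_transpose_mul_frame, toRows₁_fromRows, toRows₂_fromRows, wronskian_eq_sub, e, toC_neg,
    toC_mul, toC_mul, toC_add, toC_sub, cPlus_eq, cMinus_eq, transpose_add, transpose_smul,
    smul_neg, ← Matrix.mul_smul, ← Matrix.mul_neg, ← Matrix.mul_add, Matrix.add_mul,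
    Matrix.mul_sub, Matrix.mul_sub]
  simp only [toC_mul, toC_transpose, Matrix.mul_smul, Matrix.smul_mul, smul_smul, I_mul_I]
  congr 1
  module

theorem rows_matZ_sub (Y Yh : Frame n) :
    toC ((matZ Y)ᵀ * Yh).toRows₂ - I • toC ((matZ Y)ᵀ * Yh).toRows₁ =
      toC (matK Y) * ((cMinus Y)ᵀ * cPlus Yh) := by
  have e : Yᵀ * Yh = Y.toRows₁ᵀ * Yh.toRows₁ + Y.toRows₂ᵀ * Yh.toRows₂ := by
    conv_lhs => rw [← fromRows_toRows Y, ← fromRows_toRows Yh]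
    rw [transpose_fromRows, fromCols_mul_fromRows]
  rw [matZ_transpose_mul_frame, toRows₁_fromRows, toRows₂_fromRows, wronskian_eq_sub, e, toC_neg,
    toC_mul, toC_mul, toC_add, toC_sub, cPlus_eq, cMinus_eq, transpose_sub, transpose_smul,
    smul_neg, ← Matrix.mul_smul, ← Matrix.mul_neg, ← Matrix.mul_sub, Matrix.sub_mul,
    Matrix.mul_add, Matrix.mul_add]
  simp only [toC_mul, toC_transpose, Matrix.mul_smul, Matrix.smul_mul, smul_smul, I_mul_I]
  congr 1
  module

/-- Symmetry of $X^TU$ makes $(X+iU)(X-iU)^{-1}$ a symmetric matrix. This brings the $Y$-factors of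
$\Gamma$ to the shape in which they occur in the phase of $Z_Y^T\hat Y$. -/
theorem IsLagrangian.cPlus_mul_inv {Y : Frame n} (h : IsLagrangian Y) :
    cPlus Y * (cMinus Y)⁻¹ = ((cMinus Y)ᵀ)⁻¹ * (cPlus Y)ᵀ := by
  have e : (cMinus Y)ᵀ * cPlus Y = (cPlus Y)ᵀ * cMinus Y := by
    have hc : (toC Y.toRows₁)ᵀ * toC Y.toRows₂ = (toC Y.toRows₂)ᵀ * toC Y.toRows₁ := by
      rw [← toC_transpose, ← toC_transpose, ← toC_mul, ← toC_mul, h.comm]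
    rw [cPlus_eq, cMinus_eq, transpose_add, transpose_sub, transpose_smul, Matrix.sub_mul,
      Matrix.add_mul, Matrix.mul_add, Matrix.mul_add, Matrix.mul_sub, Matrix.mul_sub]
    simp only [Matrix.mul_smul, Matrix.smul_mul, smul_smul, I_mul_I, hc]
    module
  have ht : IsUnit ((cMinus Y)ᵀ).det := by rw [det_transpose]; exact h.isUnit_cMinus
  have e2 := congrArg (fun M => ((cMinus Y)ᵀ)⁻¹ * M * (cMinus Y)⁻¹) e
  simp only [← Matrix.mul_assoc, nonsing_inv_mul _ ht, Matrix.one_mul] at e2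
  rw [e2, mul_nonsing_inv_cancel_right _ _ h.isUnit_cMinus]

theorem IsLagrangian.neg_matGamma {Y Yh : Frame n} (h : IsLagrangian Y) (h' : IsLagrangian Yh) :
    -matGamma Y Yh = cPlus Yh * phase ((matZ Y)ᵀ * Yh) * (cPlus Yh)⁻¹ := by
  have hK := isUnit_det_toC h.isUnit_matK
  rw [phase, rows_matZ_add, rows_matZ_sub, Matrix.mul_inv_rev, Matrix.mul_inv_rev, matGamma, neg_neg,
    h.cPlus_mul_inv]
  congr 1
  calc ((cMinus Y)ᵀ)⁻¹ * (cPlus Y)ᵀ * cMinus Yh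
      = cPlus Yh * ((cPlus Yh)⁻¹ * (((cMinus Y)ᵀ)⁻¹ * ((toC (matK Y))⁻¹ * (toC (matK Y) *
        ((cPlus Y)ᵀ * cMinus Yh))))) := by
        rw [nonsing_inv_mul_cancel_left _ _ hK, mul_nonsing_inv_cancel_left _ _ h'.isUnit_cPlus]
        simp only [Matrix.mul_assoc]
    _ = _ := by simp only [Matrix.mul_assoc]

/-- Because $\mathcal J^T\mathcal J=I$, the blocks $S_{11}$ and $S_{12}$ are the lower and upper
blocks of $Z_Y^T\hat Y$ times $K_{\hat Y}$. -/
theorem matW_transpose_mul (Y Yh : Frame n) :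
    matW ((matZ Y)ᵀ * matZ Yh) =
      (toC (matK Yh))⁻¹ * phase ((matZ Y)ᵀ * Yh) * toC (matK Yh) := by
  have e1 : ((matZ Y)ᵀ * matZ Yh).toBlocks₁₂ = ((matZ Y)ᵀ * Yh).toRows₁ * matK Yh := by
    rw [matZ_transpose_mul_frame, matZ, matZ, transpose_fromCols, fromRows_mul_fromCols,
      toBlocks_fromBlocks₁₂, toRows₁_fromRows]
    simp only [transpose_mul, matK_transpose, calJ_transpose, Matrix.mul_neg, Matrix.neg_mul,
      wronskian, Matrix.mul_assoc]
  have e2 : ((matZ Y)ᵀ * matZ Yh).toBlocks₁₁ = ((matZ Y)ᵀ * Yh).toRows₂ * matK Yh := by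
    rw [matZ_transpose_mul_frame, matZ, matZ, transpose_fromCols, fromRows_mul_fromCols,
      toBlocks_fromBlocks₁₁, toRows₂_fromRows]
    have hJ : ∀ M : Matrix (Fin n ⊕ Fin n) (Fin n) ℝ, calJ n * (calJ n * M) = -M := fun M => by
      rw [← Matrix.mul_assoc, calJ_mul_calJ]; simp
    simp only [transpose_mul, matK_transpose, calJ_transpose, Matrix.mul_neg, Matrix.neg_mul,
      Matrix.mul_assoc, hJ, neg_neg]
  rw [matW, e1, e2]
  change (toC _ - I • toC _)⁻¹ * (toC _ + I • toC _) = _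
  rw [toC_mul, toC_mul, ← Matrix.smul_mul, ← Matrix.sub_mul, ← Matrix.add_mul, Matrix.mul_inv_rev,
    phase]
  simp only [Matrix.mul_assoc]

theorem charpoly_inv_mul_mul {P : Matrix (Fin n) (Fin n) ℂ} (hP : IsUnit P.det)
    (M : Matrix (Fin n) (Fin n) ℂ) : (P⁻¹ * M * P).charpoly = M.charpoly := by
  rw [charpoly_mul_comm, ← Matrix.mul_assoc, mul_nonsing_inv _ hP, Matrix.one_mul]

/-- The half turn in $e^{i(\pi+\theta)}$ absorbs the minus sign of $\Gamma$. -/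
theorem IsLagrangian.gammaShift_eq {Y Yh : Frame n} (h : IsLagrangian Y) (h' : IsLagrangian Yh)
    (θ : ℝ) : gammaShift Y Yh (Real.pi + θ) =
      -(cPlus Yh * (phase ((matZ Y)ᵀ * Yh) - exp (I * θ) • 1) * (cPlus Yh)⁻¹) := by
  have e : exp (I * ((Real.pi + θ : ℝ) : ℂ)) = -exp (I * θ) := by
    rw [ofReal_add, mul_add, exp_add, mul_comm I, exp_pi_mul_I]; ring
  rw [Matrix.mul_sub, Matrix.sub_mul, ← h.neg_matGamma h', gammaShift, e]
  simp only [Matrix.mul_smul, Matrix.mul_one, Matrix.smul_mul,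
    mul_nonsing_inv _ h'.isUnit_cPlus]
  module

theorem IsLagrangian.isUnit_gammaShift_iff {Y Yh : Frame n} (h : IsLagrangian Y)
    (h' : IsLagrangian Yh) (θ : ℝ) : IsUnit (gammaShift Y Yh (Real.pi + θ)) ↔
      exp (I * θ) ∉ (phase ((matZ Y)ᵀ * Yh)).charpoly.roots := by
  have hP := h'.isUnit_cPlus
  rw [h.gammaShift_eq h', IsUnit.neg_iff, Matrix.isUnit_iff_isUnit_det, det_mul, det_mul,
    mul_right_comm, ← det_mul, mul_nonsing_inv _ hP, det_one, one_mul,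
    ← Matrix.isUnit_iff_isUnit_det, Polynomial.mem_roots (charpoly_monic _).ne_zero,
    ← Matrix.mem_spectrum_iff_isRoot_charpoly, spectrum.mem_iff, not_not, ← IsUnit.neg_iff, neg_sub,
    Algebra.algebraMap_eq_smul_one]

/-- The phase is diagonalizable, so kernel dimensions equal algebraic multiplicities. -/
theorem defect_gammaShift {Y Yh : Frame n} (h : IsLagrangian Y) (h' : IsLagrangian Yh)
    (hF : IsLagrangian ((matZ Y)ᵀ * Yh)) (θ : ℝ) : defect (gammaShift Y Yh (Real.pi + θ)) =
      (phase ((matZ Y)ᵀ * Yh)).charpoly.roots.count (exp (I * θ)) := by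
  obtain ⟨κ, hκ, -⟩ := hF.exists_tilt hF
  obtain ⟨P, Q, d, h1, -, h3⟩ := hF.phase_eq hκ
  have hP := h'.isUnit_cPlus
  have hd := defect_sub_smul_one (M := cPlus Yh * phase ((matZ Y)ᵀ * Yh) * (cPlus Yh)⁻¹)
    (P := cPlus Yh * P) (Q := Q * (cPlus Yh)⁻¹) (d := fun i => exp (I * branch κ (d i)))
    (by rw [Matrix.mul_assoc, nonsing_inv_mul_cancel_left _ _ hP, h1])
    (by rw [h3]; simp only [Matrix.mul_assoc]) (exp (I * θ))
  have e : (cPlus Yh * phase ((matZ Y)ᵀ * Yh) * (cPlus Yh)⁻¹).charpoly =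
      (phase ((matZ Y)ᵀ * Yh)).charpoly := by
    rw [charpoly_mul_comm, ← Matrix.mul_assoc, nonsing_inv_mul _ hP, Matrix.one_mul]
  rw [e] at hd
  have e' : cPlus Yh * (phase ((matZ Y)ᵀ * Yh) - exp (I * θ) • 1) * (cPlus Yh)⁻¹ =
      cPlus Yh * phase ((matZ Y)ᵀ * Yh) * (cPlus Yh)⁻¹ - exp (I * θ) • 1 := by
    rw [Matrix.mul_sub, Matrix.sub_mul, Matrix.mul_smul, Matrix.mul_one, Matrix.smul_mul,
      mul_nonsing_inv _ hP]
  rw [← hd, h.gammaShift_eq h', e', defect, defect]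
  have hker : ∀ f : (Fin n → ℂ) →ₗ[ℂ] (Fin n → ℂ), LinearMap.ker (-f) = LinearMap.ker f :=
    fun f => by ext; simp
  rw [map_neg, hker]

end Phase

/-! ### The Maslov index through angles -/

section Maslov

open Complex

variable {n : ℕ}

theorem floor_sub_floor_sub {x e : ℝ} (h0 : 0 < e) (h1 : e < 1) :
    ⌊x⌋ - ⌊x - e⌋ = if Int.fract x < e then 1 else 0 := by
  have hx := Int.self_sub_floor x
  have hx0 := Int.fract_nonneg x
  have hx1 := Int.fract_lt_one x
  split_ifs with h
  · have : ⌊x - e⌋ = ⌊x⌋ - 1 := by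
      rw [Int.floor_eq_iff]; push_cast; constructor <;> linarith
    omega
  · have : ⌊x - e⌋ = ⌊x⌋ := by
      rw [Int.floor_eq_iff]; constructor <;> linarith
    omega

/-- The count of eigenvalues on an arc in terms of integers of angles. -/
theorem arcCount_eq {Y Yh : Frame n} (h : IsLagrangian Y) (h' : IsLagrangian Yh)
    (hF : IsLagrangian ((matZ Y)ᵀ * Yh)) {φ : Fin n → ℝ}
    (hφ : (phase ((matZ Y)ᵀ * Yh)).charpoly.roots =
      Finset.univ.val.map fun j => exp (I * (φ j : ℂ))) {ε : ℝ} (hε : ε ∈ Set.Ioo 0 Real.pi) :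
    (arcCount Y Yh ε : ℤ) = ∑ j, windInt (φ j) - ∑ j, windInt (φ j - ε) := by
  have hpi := Real.pi_pos
  have h2pi : 0 < 2 * Real.pi := by positivity
  -- The representative of $\varphi_j$ in $[0,2\pi)$; the arc count becomes the number of $j$ with
  -- $r_j<\varepsilon$.
  let r : Fin n → ℝ := fun j => 2 * Real.pi * Int.fract (φ j / (2 * Real.pi))
  have hr0 : ∀ j, 0 ≤ r j := fun j => mul_nonneg h2pi.le (Int.fract_nonneg _)
  have hr1 : ∀ j, r j < 2 * Real.pi := fun j =>
    (mul_lt_mul_of_pos_left (Int.fract_lt_one _) h2pi).trans_eq (mul_one _)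
  have hre : ∀ j, φ j = r j + 2 * Real.pi * ⌊φ j / (2 * Real.pi)⌋ := fun j => by
    simp only [r]
    rw [← mul_add, Int.fract_add_floor]
    field_simp
  have hiff : ∀ j, ∀ θ ∈ Set.Ico 0 ε, exp (I * θ) = exp (I * φ j) ↔ r j = θ := by
    intro j θ hθ
    have e : exp (I * φ j) = exp (I * r j) := exp_I_mul_eq_iff.2 ⟨_, hre j⟩
    rw [e]
    constructor
    · intro he
      obtain ⟨m, hm⟩ := exp_I_mul_eq_iff.1 he
      have hm1 : (m : ℝ) < 1 := by
        by_contra hc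
        have := mul_le_mul_of_nonneg_left (not_lt.1 hc) h2pi.le
        linarith [hθ.2, hε.2, hr0 j]
      have hm2 : (-1 : ℝ) < m := by
        by_contra hc
        have := mul_le_mul_of_nonneg_left (not_lt.1 hc) h2pi.le
        linarith [hθ.1, hr1 j]
      have hm0 : m = 0 := by
        have h1 : m < 1 := by exact_mod_cast hm1
        have h2 : -1 < m := by exact_mod_cast hm2
        omega
      rw [hm0] at hm
      simp at hm
      exact hm.symm
    · rintro rfl
      rfl
  have hcount : ∀ θ ∈ Set.Ico 0 ε, defect (gammaShift Y Yh (Real.pi + θ)) =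
      (Finset.univ.filter fun j => r j = θ).card := by
    intro θ hθ
    rw [defect_gammaShift h h' hF, hφ, Multiset.count_map, Finset.card_def, Finset.filter_val]
    exact congrArg Multiset.card (Multiset.filter_congr fun j _ => hiff j θ hθ)
  classical
  have hsum : arcCount Y Yh ε = (Finset.univ.filter fun j => r j < ε).card := by
    rw [arcCount, finsum_mem_eq_sum_of_inter_support_eq (t := (Finset.univ.filter
      fun j => r j < ε).image r)]
    · rw [Finset.card_eq_sum_card_image r]
      refine Finset.sum_congr rfl fun θ hθ => ?_
      obtain ⟨j, hj, rfl⟩ := Finset.mem_image.1 hθ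
      have hj' := (Finset.mem_filter.1 hj).2
      rw [hcount _ ⟨hr0 j, hj'⟩]
      congr 1
      ext i
      simp only [Finset.mem_filter, Finset.mem_univ, true_and]
      exact ⟨fun hi => ⟨hi ▸ hj', hi⟩, fun hi => hi.2⟩
    · ext θ
      simp only [Set.mem_inter_iff, Function.mem_support, Finset.coe_image, Set.mem_image,
        Finset.coe_filter, Finset.mem_univ, true_and, Set.mem_ofPred_eq, and_congr_left_iff]
      intro hne
      constructor
      · intro hθ
        rw [hcount θ hθ] at hne
        obtain ⟨j, hj⟩ := Finset.card_pos.1 (Nat.pos_of_ne_zero hne)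
        have hj' := (Finset.mem_filter.1 hj).2
        exact ⟨j, hj'.trans_lt hθ.2, hj'⟩
      · rintro ⟨j, hj, rfl⟩
        exact ⟨hr0 j, hj⟩
  rw [hsum, ← Finset.sum_sub_distrib, Finset.card_filter]
  push_cast
  refine Finset.sum_congr rfl fun j _ => ?_
  have he0 : 0 < ε / (2 * Real.pi) := div_pos hε.1 h2pi
  have he1 : ε / (2 * Real.pi) < 1 := by rw [div_lt_one h2pi]; linarith [hε.2]
  rw [windInt, windInt, sub_div, floor_sub_floor_sub he0 he1]
  congr 1
  rw [lt_div_iff₀ h2pi, mul_comm]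

theorem maslovValues_eq {Y Yh : ℝ → Frame n} {a b : ℝ} (hab : a < b)
    (hY : IsLagrangianPath Y a b) (hYh : IsLagrangianPath Yh a b) {φ : Fin n → ℝ → ℝ}
    (hφ : IsBranch (fun t => phase ((matZ (Y t))ᵀ * Yh t)) φ (Set.Icc a b)) :
    maslovValues Y Yh a b = {∑ j, windInt (φ j b) - ∑ j, windInt (φ j a)} := by
  have hF : ∀ t ∈ Set.Icc a b, IsLagrangian ((matZ (Y t))ᵀ * Yh t) := fun t ht => by
    rw [← (hY.2 t ht).matZ_inv]
    exact (hY.matZ_inv_mul hYh).2 t ht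
  have hiff : ∀ t ∈ Set.Icc a b, ∀ θ : ℝ, IsUnit (gammaShift (Y t) (Yh t) (Real.pi + θ)) ↔
      ∀ j, exp (I * (φ j t : ℂ)) ≠ exp (I * θ) := fun t ht θ => by
    rw [(hY.2 t ht).isUnit_gammaShift_iff (hYh.2 t ht), hφ.2 t ht]
    simp
  have h2pi : 0 < 2 * Real.pi := by positivity
  refine Set.eq_singleton_iff_nonempty_unique_mem.2 ⟨?_, ?_⟩
  · obtain ⟨p, t, ε, ht, hε⟩ := exists_isPartition_of_local hab
      -- Comparing cosines excludes $e^{i\varepsilon}$ and $e^{-i\varepsilon}$ at once; at each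
      -- $t_0$ only finitely many $\varepsilon\in(0,\pi)$ are forbidden.
      (Good := fun (ε : ℝ) s => ε ∈ Set.Ioo 0 Real.pi ∧
        ∀ t ∈ s, ∀ j, Real.cos (φ j t) ≠ Real.cos ε)
      (fun c s s' hs h => ⟨h.1, fun t ht => h.2 t (hs ht)⟩) fun t₀ ht₀ => by
        classical
        obtain ⟨ε, hε, hne⟩ := (Set.Ioo_infinite Real.pi_pos).exists_notMem_finset
          (Finset.univ.image fun j => Real.arccos (Real.cos (φ j t₀)))
        have h1 : ∀ᶠ t in 𝓝[Set.Icc a b] t₀, ∀ j, Real.cos (φ j t) ≠ Real.cos ε := by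
          refine eventually_all.2 fun j => ?_
          refine ((Real.continuous_cos.comp_continuousOn (hφ.1 j)) t₀ ht₀).eventually_ne fun h0 => ?_
          refine hne (Finset.mem_image.2 ⟨j, Finset.mem_univ _, ?_⟩)
          change Real.cos (φ j t₀) = Real.cos ε at h0
          rw [h0, Real.arccos_cos hε.1.le hε.2.le]
        rw [Metric.nhdsWithin_basis_ball.eventually_iff] at h1
        obtain ⟨δ, hδ, h1⟩ := h1
        rw [Set.inter_comm] at h1
        exact ⟨ε, δ, hδ, hε, fun t ht => h1 ht⟩
    have hcos : ∀ x y : ℝ, exp (I * x) = exp (I * y) → Real.cos x = Real.cos y := fun x y h => by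
      obtain ⟨m, rfl⟩ := exp_I_mul_eq_iff.1 h
      rw [mul_comm (2 * Real.pi)]
      exact Real.cos_add_int_mul_two_pi y m
    refine ⟨_, p, t, ε, ht, fun k => ⟨(hε k).1, fun s hs => ⟨?_, ?_⟩⟩, rfl⟩
    · rw [hiff s (ht.Icc_subset k hs)]
      exact fun j he => (hε k).2 s hs j (hcos _ _ he)
    · rw [sub_eq_add_neg, hiff s (ht.Icc_subset k hs)]
      exact fun j he => (hε k).2 s hs j ((hcos _ _ he).trans (Real.cos_neg _))
  · rintro _ ⟨p, t, ε, ht, hε, rfl⟩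
    have key : ∀ k : Fin p,
        (arcCount (Y (t k.succ)) (Yh (t k.succ)) (ε k) : ℤ) -
          arcCount (Y (t k.castSucc)) (Yh (t k.castSucc)) (ε k) =
        ∑ j, windInt (φ j (t k.succ)) - ∑ j, windInt (φ j (t k.castSucc)) := by
      intro k
      have hsub := ht.Icc_subset k
      have hr := Set.right_mem_Icc.2 (ht.le k)
      have hl := Set.left_mem_Icc.2 (ht.le k)
      -- The floor could change only if $\varphi_j-\varepsilon_k$ met $2\pi\mathbb Z$, making
      -- $e^{i(\pi+\varepsilon_k)}$ an eigenvalue of $\Gamma$.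
      have hconst : ∀ j, windInt (φ j (t k.succ) - ε k) = windInt (φ j (t k.castSucc) - ε k) := by
        intro j
        refine floor_eq_of_forall_ne isPreconnected_Icc
          (f := fun s => (φ j s - ε k) / (2 * Real.pi))
          ((((hφ.1 j).mono hsub).sub continuousOn_const).div_const _) (fun s hs m hm => ?_) hr hl
        refine (hiff s (hsub hs) (ε k)).1 ((hε k).2 s hs).1 j (exp_I_mul_eq_iff.2 ⟨m, ?_⟩)
        rw [div_eq_iff h2pi.ne'] at hm
        linarith
      rw [arcCount_eq (hY.2 _ (hsub hr)) (hYh.2 _ (hsub hr)) (hF _ (hsub hr))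
        (hφ.2 _ (hsub hr)) (hε k).1, arcCount_eq (hY.2 _ (hsub hl)) (hYh.2 _ (hsub hl))
        (hF _ (hsub hl)) (hφ.2 _ (hsub hl)) (hε k).1, Finset.sum_congr rfl fun j _ => hconst j]
      ring
    rw [maslovSum, Finset.sum_congr rfl fun k _ => key k,
      sum_telescope fun k => ∑ j, windInt (φ j (t k)), ht.first, ht.last]

theorem epsilon_mem_singleton {S : Set ℤ} {m : ℤ} (h : S = {m}) :
    Classical.epsilon (fun x : ℤ => x ∈ S) = m := by
  have : Classical.epsilon (fun x : ℤ => x ∈ S) ∈ S :=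
    Classical.epsilon_spec (p := fun x : ℤ => x ∈ S) ⟨m, by rw [h]; rfl⟩
  rw [h] at this
  simpa [h] using this

theorem isContinuousLidskiiAngles_iff {Y Yh : ℝ → Frame n} {a b : ℝ}
    (hYh : IsLagrangianPath Yh a b) {φ : Fin n → ℝ → ℝ} :
    IsContinuousLidskiiAngles (fun t => (matZ (Y t))ᵀ * matZ (Yh t)) φ a b ↔
      IsBranch (fun t => phase ((matZ (Y t))ᵀ * Yh t)) φ (Set.Icc a b) := by
  refine and_congr Iff.rfl (forall₂_congr fun t ht => ?_)
  rw [IsLidskiiAngles, matW_transpose_mul,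
    charpoly_inv_mul_mul (isUnit_det_toC (hYh.2 t ht).isUnit_matK)]

end Maslov

end OscMaslov

/-- The values of the Maslov index and of the oscillation numbers do not depend on the choices in
their definitions, the Maslov index is the total change of the integers of the continuous Lidskii
angles of `S = Z_Yᵀ Z_Ŷ`, and it equals the oscillation numbers of `Z⁻¹ Ŷ` and `Z_Y⁻¹ Ŷ`. -/
theorem theoremT (n : ℕ) (a b : ℝ) (hab : a < b) (Y Yh : ℝ → Frame n)
    (hY : IsLagrangianPath Y a b) (hYh : IsLagrangianPath Yh a b) :
    maslovValues Y Yh a b = {maslovIndex Y Yh a b} ∧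
    (∃ φ : Fin n → ℝ → ℝ,
      IsContinuousLidskiiAngles (fun t => (matZ (Y t))ᵀ * matZ (Yh t)) φ a b) ∧
    (∀ φ : Fin n → ℝ → ℝ,
      IsContinuousLidskiiAngles (fun t => (matZ (Y t))ᵀ * matZ (Yh t)) φ a b →
        maslovIndex Y Yh a b = ∑ j, (windInt (φ j b) - windInt (φ j a))) ∧
    (∀ Z : ℝ → BMat n, ContinuousOn Z (Set.Icc a b) →
      (∀ t ∈ Set.Icc a b, IsSymplectic (Z t)) →
      (∀ t ∈ Set.Icc a b, Z t * vertE n = Y t) →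
        IsLagrangianPath (fun t => (Z t)⁻¹ * Yh t) a b ∧
        oscValues (fun t => (Z t)⁻¹ * Yh t) a b =
          {oscNumber (fun t => (Z t)⁻¹ * Yh t) a b} ∧
        maslovIndex Y Yh a b = oscNumber (fun t => (Z t)⁻¹ * Yh t) a b) ∧
    (IsLagrangianPath (fun t => (matZ (Y t))⁻¹ * Yh t) a b ∧
      oscValues (fun t => (matZ (Y t))⁻¹ * Yh t) a b =
        {oscNumber (fun t => (matZ (Y t))⁻¹ * Yh t) a b} ∧
      maslovIndex Y Yh a b = oscNumber (fun t => (matZ (Y t))⁻¹ * Yh t) a b) ∧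
    (∀ t ∈ Set.Icc a b,
      (matZ (Y t))⁻¹ = (matZ (Y t))ᵀ ∧
      (matZ (Y t))⁻¹ * Yh t =
        fromRows (-(matK (Y t) * wronskian (Y t) (Yh t))) (matK (Y t) * ((Y t)ᵀ * Yh t))) := by
  have hF := hY.matZ_inv_mul hYh
  obtain ⟨φ, hφ⟩ := hF.exists_isBranch hab
  have hcongr : ∀ t ∈ Set.Icc a b, (matZ (Y t))⁻¹ * Yh t = (matZ (Y t))ᵀ * Yh t :=
    fun t ht => by rw [(hY.2 t ht).matZ_inv]
  have hiff : ∀ ψ : Fin n → ℝ → ℝ,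
      IsBranch (fun t => phase ((matZ (Y t))ᵀ * Yh t)) ψ (Set.Icc a b) ↔
        IsBranch (fun t => phase ((matZ (Y t))⁻¹ * Yh t)) ψ (Set.Icc a b) := fun ψ =>
    and_congr Iff.rfl (forall₂_congr fun t ht => by simp only [hcongr t ht])
  have hM := maslovValues_eq hab hY hYh ((hiff φ).2 hφ)
  have hO := oscValues_eq hab hF hφ
  have hMi : maslovIndex Y Yh a b = _ := epsilon_mem_singleton hM
  refine ⟨by rw [hMi, hM], ⟨φ, (isContinuousLidskiiAngles_iff hYh).2 ((hiff φ).2 hφ)⟩,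
    fun ψ hψ => ?_, fun Z hZ hZs hZE => ?_, ⟨hF, ?_, ?_⟩, fun t ht => ⟨(hY.2 t ht).matZ_inv, ?_⟩⟩
  · have hM' := maslovValues_eq hab hY hYh ((isContinuousLidskiiAngles_iff hYh).1 hψ)
    rw [show maslovIndex Y Yh a b = _ from epsilon_mem_singleton hM', Finset.sum_sub_distrib]
  · have hG := hYh.symplectic_mul (ContinuousOn.inv_of_isSymplectic hZ hZs)
      fun t ht => (hZs t ht).inv
    have hsub : oscValues (fun t => (Z t)⁻¹ * Yh t) a b ⊆
        oscValues (fun t => (matZ (Y t))⁻¹ * Yh t) a b := by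
      refine oscValues_subset_of_lower (L := fun t => (matZ (Y t))⁻¹ * Z t) hG
        ((ContinuousOn.inv_of_isSymplectic (continuousOn_matZ hY)
          fun t ht => (hY.2 t ht).isSymplectic_matZ).mul hZ)
        (fun t ht => (hY.2 t ht).isSymplectic_matZ.inv.mul (hZs t ht)) (fun t ht => ?_)
        fun t ht => ?_
      -- The upper right block is the upper block of $Z_Y^{-1}ZE=Z_Y^{-1}Y$, namely $-K_YW(Y,Y)=0$.
      · have e : ((matZ (Y t))⁻¹ * Z t).toBlocks₁₂ =
            ((matZ (Y t))⁻¹ * Z t * vertE n).toRows₁ := by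
          conv_rhs => rw [← fromBlocks_toBlocks ((matZ (Y t))⁻¹ * Z t), vertE,
            fromBlocks_mul_fromRows]
          simp
        rw [e, Matrix.mul_assoc, hZE t ht, (hY.2 t ht).matZ_inv, matZ_transpose_mul_frame,
          toRows₁_fromRows, wronskian, (hY.2 t ht).1]
        simp
      · rw [Matrix.mul_assoc, mul_nonsing_inv_cancel_left _ _ (hZs t ht).isUnit_det]
    -- A nonempty subset of a singleton is that singleton, so one inclusion of value sets suffices.
    have hO' := (oscValues_nonempty hab hG).subset_singleton_iff.1 (hsub.trans hO.subset)
    have hOi : oscNumber (fun t => (Z t)⁻¹ * Yh t) a b = _ := epsilon_mem_singleton hO'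
    exact ⟨hG, by rw [hOi, hO'], by rw [hOi, hMi]⟩
  · rw [show oscNumber (fun t => (matZ (Y t))⁻¹ * Yh t) a b = _ from epsilon_mem_singleton hO, hO]
  · rw [show oscNumber (fun t => (matZ (Y t))⁻¹ * Yh t) a b = _ from epsilon_mem_singleton hO, hMi]
  · rw [hcongr t ht, matZ_transpose_mul_frame]
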